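/- Ranked alphabets are finite, and $T_\Sigma(Z)$ denotes the set of trees over $\Sigma$ with extra leaves labelled in $Z$, $T_\Sigma=T_\Sigma(\emptyset)$. A tree homomorphism $h\colon T_\Sigma\to T_\Delta$ is given by trees $h(\sigma)\in T_\Delta(\{x_1,\dots,x_k\})$ for each $\sigma\in\Sigma$ of rank $k$. It is \emph{tetris-free} if every $h(\sigma)$ contains all variables $x_1,\dots,x_k$ ($k$ the rank of $\sigma$), no $h(\sigma)$ is a variable, and $h(s)=h(s')$ implies that $s,s'$ have the same positions and $h(s(p))=h(s'(p))$ for the labels at every position $p$. Let $\mathbb F$ be a field. A \emph{weighted tree automaton} (WTA) over $\mathbb F$ and $\Sigma$ has a finite set $Q$ of states, a set $F\subseteq Q$ of final states and a finite set of weighted rules $\sigma(q_1,\dots,q_k)\to q$. A \emph{weighted tree automaton with hom-constraints} (WTAh) over $\Delta$ has instead finitely many weighted rules $\ell\xrightarrow{E}q$ with $\ell\in T_\Delta(Q)\setminus Q$ and $E$ an equivalence relation on the set of positions of $\ell$ labelled by states. Inductively, if $\varrho_i$ is a run for $t_i$ to $q_i$ for each state position $p_i$ of $\ell$ (with label $q_i$),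 and $t_i=t_j$ whenever $(p_i,p_j)\in E$, then a rule $\ell\xrightarrow{E}q$ yields a run to $q$ for the tree obtained from $\ell$ by putting $t_i$ at $p_i$; the run is the tree obtained from $\ell$ by relabelling its root with the rule and putting $\varrho_i$ at $p_i$. The weight of a run is the product of the weights of its rules; a run is accepting if its weight is nonzero and its target state is final. $[\![\mathcal A']\!](t)$ is the sum of the weights of all runs for $t$ to final states. A position of $\ell$ is constrained by $E$ if it is $E$-related to another position. For a WTA $\mathcal A$ over $\mathbb F$ and $\Sigma$ with state set $Q$ and a tetris-free $h$, let $\mathcal A'$ be the following WTAh for $h([\![\mathcal A]\!])$. Its states are $Q\,\dot\cup\,\{\bot\}$, with the same final states as $\mathcal A$. Each rule $\sigma(q_1,\dots,q_k)\to q$ of $\mathcal A$ gives the rule $\ell\xrightarrow{E}q$, where $\ell$ arises from $h(\sigma)$ by replacing, for each $i$, the lexicographically least occurrence of $x_i$ by $q_i$ and all other occurrences by $\bot$, and $E$ relates two positions iff they carry the same variable in $h(\sigma)$; weights of rules that become identical are added. In addition there are the rules $\delta(\bot,\dots,\bot)\to\bot$ of weight $1$ for all $\delta\in\Delta$. For $N\in\mathbb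 N$, $\mathcal A'$ has the \emph{large duplication property} (LDP) with respect to $N$ if there are a tree $t$ with $[\![\mathcal A']\!](t)\ne0$, an accepting run $\varrho$ for $t$, a position $p$ of $\varrho$ labelled by a rule with constraint set $E$, and a position $p'$ constrained by $E$ such that the subtree $t|_{pp'}$ has height at least $N$. A set $W$ of positions of $t$ is a \emph{class of mutually constrained positions in $t$} if, for some accepting run for $t$, $W$ is the class of such a position $pp'$ under the least equivalence relation that contains all pairs $(puv,pu'v)$ with $(u,u')$ in the constraint set of the rule applied at $p$. $N$ is a \emph{pumping constant} of $\mathcal A'$ if for every $C\in T_\Delta(\{\Box\})$ and $t_0\in T_\Delta$ of height at least $N$ such that $[\![\mathcal A']\!](C[t_0])\neq0$ and the set of $\Box$-positions of $C$ is a class of mutually constrained positions in $C[t_0]$, there are infinitely many trees $t$ such that $[\![\mathcal A']\!](C[t])\neq0$ and the set of $\Box$-positions of $C$ is a class of mutually constrained positions in $C[t]$. The LDP of $\mathcal A'$ is the LDP with respect to a pumping constant of $\mathcal A'$. \textbf{Proposition.} Let $\mathbb F$ be a field whose elements are effectively encoded such that addition and multiplication are computable. Given as input a WTA $\mathcal A$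 over $\mathbb F$ and a tetris-free tree homomorphism $h$, it is decidable whether $\mathcal A'$ has the LDP. More precisely, there are a computable function that assigns to each such input $(\mathcal A,h)$ a pumping constant of $\mathcal A'$, and an algorithm that, given $(\mathcal A,h)$ with $h$ tetris-free and any $N\in\mathbb N$, halts and decides whether $\mathcal A'$ has the LDP with respect to $N$. -/

import Mathlib

/-! ### Trees over a ranked alphabet -/

/-- `RTree rk Z` is the set of trees over the ranked alphabet `(S, rk)` with additional leaves
labelled in `Z`.  Ground trees are the elements of `RTree rk Empty`. -/
inductive RTree {S : Type} (rk : S → ℕ) (Z : Type) : Type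
  | var : Z → RTree rk Z
  | node : (s : S) → (Fin (rk s) → RTree rk Z) → RTree rk Z

namespace RTree

variable {S : Type} {rk : S → ℕ} {Z Z' : Type}

/-- The subtree of `t` at a position, or `none` if the word is not a position of `t`.  Positions
are words over `ℕ`; the children of a node are numbered from `0`. -/
def sub : RTree rk Z → List ℕ → Option (RTree rk Z)
  | t, [] => some t
  | var _, _ :: _ => none
  | node s ts, i :: p => if hi : i < rk s then sub (ts ⟨i, hi⟩) p else none

/-- The set of positions of a tree. -/
def positions (t : RTree rk Z) : Set (List ℕ) := {p | (t.sub p).isSome}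

/-- The label at the root. -/
def rootLabel : RTree rk Z → S ⊕ Z
  | var z => .inr z
  | node s _ => .inl s

/-- The label of `t` at a position, or `none` if the word is not a position of `t`. -/
def label (t : RTree rk Z) (p : List ℕ) : Option (S ⊕ Z) := (t.sub p).map rootLabel

/-- The height of a tree, the maximal length of a position. -/
def height : RTree rk Z → ℕ
  | var _ => 0
  | node _ ts => Finset.univ.sup fun i => height (ts i) + 1

/-- Replace every leaf that is labelled by some `z : Z`, at position `p`, by the tree `f p z`. -/
def fill : RTree rk Z → (List ℕ → Z → RTree rk Z') → RTree rk Z'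
  | var z, f => f [] z
  | node s ts, f => node s fun i => fill (ts i) fun p => f (i :: p)

/-- Replace every leaf labelled by some `z : Z` by the tree `θ z`. -/
def subst (t : RTree rk Z) (θ : Z → RTree rk Z') : RTree rk Z' := t.fill fun _ z => θ z

theorem sub_fill_var (u : RTree rk Z) (g : List ℕ → Z → Z') (p : List ℕ) (y : Z') :
    (u.fill fun p z => var (g p z)).sub p = some (var y) ↔
      ∃ z, u.sub p = some (var z) ∧ g p z = y := by
  induction u generalizing g p with
  | var z => cases p <;> simp [fill, sub]
  | node s ts ih =>
    cases p with
    | nil => simp [fill, sub]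
    | cons i p =>
      by_cases hi : i < rk s
      · simpa [fill, sub, hi] using ih ⟨i, hi⟩ (fun p => g (i :: p)) p
      · simp [fill, sub, hi]

end RTree

/-! ### Tree homomorphisms -/

/-- A tree homomorphism, given by a tree `h s` over the output alphabet for every input symbol
`s`; the variables of `h s` are `x_i` with `i : Fin (rk s)`. -/
def TreeHom {S D : Type} (rkS : S → ℕ) (rkD : D → ℕ) : Type :=
  (s : S) → RTree rkD (Fin (rkS s))

namespace TreeHom

variable {S D : Type} {rkS : S → ℕ} {rkD : D → ℕ}

/-- The induced map on ground trees. -/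
def apply (h : TreeHom rkS rkD) : RTree rkS Empty → RTree rkD Empty
  | .var e => e.elim
  | .node s ts => RTree.subst (h s) fun i => apply h (ts i)

/-- The tree assigned to the symbol `s`, as a tree over the common set `x_0, x_1, …` of
variables, so that the trees of symbols of different ranks can be compared. -/
def symbolImage (h : TreeHom rkS rkD) (s : S) : RTree rkD ℕ :=
  RTree.subst (h s) fun i => .var i.val

def Nonerasing (h : TreeHom rkS rkD) : Prop := ∀ s i, h s ≠ .var i

def Nondeleting (h : TreeHom rkS rkD) : Prop :=
  ∀ s i, ∃ p, RTree.sub (h s) p = some (.var i)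

structure TetrisFree (h : TreeHom rkS rkD) : Prop where
  nondeleting : h.Nondeleting
  nonerasing : h.Nonerasing
  positions_eq : ∀ s s', h.apply s = h.apply s' → s.positions = s'.positions
  image_eq : ∀ s s', h.apply s = h.apply s' → ∀ p a b,
    s.label p = some (.inl a) → s'.label p = some (.inl b) → h.symbolImage a = h.symbolImage b

end TreeHom

/-! ### Weighted tree automata -/

/-- A rule `sym(states 0, …, states (k-1)) → target`. -/
structure WTARule {S : Type} (rk : S → ℕ) (Q : Type) : Type where
  sym : S
  states : Fin (rk sym) → Q
  target : Q

/-- A weighted tree automaton.  Only the values of `wt` on `rules` are relevant. -/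
structure WTA (K : Type*) (Q : Type) {S : Type} (rk : S → ℕ) where
  final : Finset Q
  rules : Finset (WTARule rk Q)
  wt : WTARule rk Q → K

/-! ### Weighted tree automata with hom-constraints -/

/-- A rule `ℓ →[E] target` of a weighted tree automaton with hom-constraints.  Its left-hand side
`ℓ = root(args 0, …, args (k-1))` is a tree with leaves in `Q` that is not itself a state, and
`E` is an equivalence relation on the set of positions of `ℓ` labelled by states. -/
structure HRule {S : Type} (rk : S → ℕ) (Q : Type) : Type where
  root : S
  args : Fin (rk root) → RTree rk Q
  target : Q
  E : List ℕ → List ℕ → Prop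
  E_left : ∀ p p', E p p' → ∃ q, (RTree.node root args).sub p = some (.var q)
  E_refl : ∀ p q, (RTree.node root args).sub p = some (.var q) → E p p
  E_symm : ∀ p p', E p p' → E p' p
  E_trans : ∀ p p' p'', E p p' → E p' p'' → E p p''

/-- The left-hand side of a rule. -/
def HRule.lhs {S : Type} {rk : S → ℕ} {Q : Type} (r : HRule rk Q) : RTree rk Q :=
  .node r.root r.args

/-- The rank function of the alphabet `S ∪ R` of runs. -/
abbrev runRank {S : Type} (rk : S → ℕ) (Q : Type) : S ⊕ HRule rk Q → ℕ :=
  Sum.elim rk fun r => rk r.root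

/-- Ground trees over the alphabet `S ∪ R`. -/
abbrev RunTree {S : Type} (rk : S → ℕ) (Q : Type) : Type := RTree (runRank rk Q) Empty

/-- Replace every state leaf of `ℓ`, at position `p`, by `ϱ p`. -/
def RTree.graft {S : Type} {rk : S → ℕ} {Q : Type} :
    RTree rk Q → (List ℕ → RunTree rk Q) → RunTree rk Q
  | .var _, ϱ => ϱ []
  | .node s ts, ϱ => .node (.inl s) fun i => RTree.graft (ts i) fun p => ϱ (i :: p)

/-- The left-hand side of `r` with its root relabelled by `r` and with `ϱ p` in place of the state
at position `p`. -/
def HRule.graft {S : Type} {rk : S → ℕ} {Q : Type} (r : HRule rk Q)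
    (ϱ : List ℕ → RunTree rk Q) : RunTree rk Q :=
  .node (.inr r) fun i => (r.args i).graft fun p => ϱ (i :: p)

/-- A weighted tree automaton with hom-constraints.  Only the values of `wt` on `rules` are
relevant. -/
structure WTAh (K : Type*) (Q : Type) {S : Type} (rk : S → ℕ) where
  final : Finset Q
  rules : Set (HRule rk Q)
  rules_finite : rules.Finite
  wt : HRule rk Q → K

namespace WTAh

variable {K : Type*} [CommSemiring K] {Q S : Type} {rk : S → ℕ}

/-- `M.IsRun ϱ t q`: `ϱ` is a run of `M` for the tree `t` to the state `q`. -/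
inductive IsRun (M : WTAh K Q rk) : RunTree rk Q → RTree rk Empty → Q → Prop
  | step (r : HRule rk Q) (hr : r ∈ M.rules)
      (ϱ : List ℕ → RunTree rk Q) (t : List ℕ → RTree rk Empty)
      (hrun : ∀ p q, r.lhs.sub p = some (.var q) → IsRun M (ϱ p) (t p) q)
      (hE : ∀ p p', r.E p p' → t p = t p') :
      IsRun M (r.graft ϱ) (r.lhs.fill fun p _ => t p) r.target

/-- The weight of a run: the product of the weights of its rules. -/
def weight (M : WTAh K Q rk) : RunTree rk Q → K
  | .var e => e.elim
  | .node x ts => Sum.elim (fun _ => 1) M.wt x * ∏ i, weight M (ts i)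

/-- The sum of the weights of all runs for `t` to `q` (there are only finitely many). -/
noncomputable def stateWeight (M : WTAh K Q rk) (t : RTree rk Empty) (q : Q) : K :=
  ∑ᶠ ϱ ∈ {ϱ | M.IsRun ϱ t q}, M.weight ϱ

/-- The recognized tree series. -/
noncomputable def series (M : WTAh K Q rk) (t : RTree rk Empty) : K :=
  ∑ q ∈ M.final, M.stateWeight t q

def IsAcceptingRun (M : WTAh K Q rk) (ϱ : RunTree rk Q) (t : RTree rk Empty) : Prop :=
  ∃ q ∈ M.final, M.IsRun ϱ t q ∧ M.weight ϱ ≠ 0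

/-- `DirectlyConstrained ϱ p p'`: the rule that the run `ϱ` applies at `p` constrains the position
`p'` of its left-hand side to be equal to some other position. -/
def DirectlyConstrained (ϱ : RunTree rk Q) (p p' : List ℕ) : Prop :=
  ∃ r p'', ϱ.label p = some (.inl (.inr r)) ∧ r.E p' p'' ∧ p' ≠ p''

/-- The large duplication property with respect to the height bound `N`: some tree in the support
has an accepting run with a constrained position whose subtree has height at least `N`. -/
def HasLDP (M : WTAh K Q rk) (N : ℕ) : Prop :=
  ∃ t ϱ p p' t', M.series t ≠ 0 ∧ M.IsAcceptingRun ϱ t ∧ DirectlyConstrained ϱ p p' ∧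
    t.sub (p ++ p') = some t' ∧ N ≤ t'.height

/-- A constraint `(u, u')` of the rule applied at `p` forces the subtrees at `pu` and `pu'` to be
equal, hence also those at `puv` and `pu'v` for every `v`. -/
def ForcedEqual (ϱ : RunTree rk Q) (w w' : List ℕ) : Prop :=
  ∃ p r u u' v, ϱ.label p = some (.inl (.inr r)) ∧ r.E u u' ∧
    w = p ++ u ++ v ∧ w' = p ++ u' ++ v

/-- `W` is an equivalence class of mutually constrained positions in `t`: the class of a
constrained position, under the equivalence relation generated by the constraints of a run. -/
def IsConstrainedClass (M : WTAh K Q rk) (t : RTree rk Empty) (W : Set (List ℕ)) : Prop :=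
  ∃ ϱ p p', M.IsAcceptingRun ϱ t ∧ DirectlyConstrained ϱ p p' ∧
    W = {w | Relation.EqvGen (ForcedEqual ϱ) (p ++ p') w}

/-- `N` is a pumping constant of `M`: for every multi-context `C` (a tree with leaves labelled by
the placeholder `()`) and every `t₀` of height at least `N` such that `C[t₀]` is in the support and
the placeholders of `C` form a class of mutually constrained positions in `C[t₀]`, there are
infinitely many `t` such that the same is true of `C[t]`. -/
def IsPumpingConstant (M : WTAh K Q rk) (N : ℕ) : Prop :=
  ∀ (C : RTree rk Unit) (t₀ : RTree rk Empty),
    M.series (C.subst fun _ => t₀) ≠ 0 → N ≤ t₀.height →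
    M.IsConstrainedClass (C.subst fun _ => t₀) {p | C.sub p = some (.var ())} →
    {t : RTree rk Empty | M.series (C.subst fun _ => t) ≠ 0 ∧
      M.IsConstrainedClass (C.subst fun _ => t) {p | C.sub p = some (.var ())}}.Infinite

end WTAh

/-! ### The automaton for the homomorphic image

The sink state is `none : Option Q`. -/

section Image

variable {S D : Type} {rkS : S → ℕ} {rkD : D → ℕ} {Q : Type}

open Classical in
/-- The state that replaces the occurrence of the variable `x_j` at position `p` in `u`: the
state `qs j` at the lexicographically least occurrence, the sink state at all others. -/
noncomputable def markVar {k : ℕ} (u : RTree rkD (Fin k)) (qs : Fin k → Q) (p : List ℕ)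
    (j : Fin k) : Option Q :=
  if ∀ p', u.sub p' = some (.var j) → p ≤ p' then some (qs j) else none

/-- The rule with left-hand side `u`, in which the variables have been replaced by states as in
`markVar`, and with the constraints that all occurrences of the same variable are equal. -/
noncomputable def markRule {k : ℕ} (u : RTree rkD (Fin k)) (hu : ∀ i, u ≠ .var i)
    (qs : Fin k → Q) (q : Q) : HRule rkD (Option Q) :=
  match u, hu with
  | .var i, hu => absurd rfl (hu i)
  | .node d us, _ =>
    { root := d
      args := fun i => (us i).fill fun p j => .var (markVar (.node d us) qs (i.val :: p) j)
      target := some q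
      E := fun p p' => ∃ j, (RTree.node d us).sub p = some (.var j) ∧
        (RTree.node d us).sub p' = some (.var j)
      E_left := by
        rintro p p' ⟨j, hp, -⟩
        exact ⟨_, (RTree.sub_fill_var (.node d us) (markVar (.node d us) qs) p _).2
          ⟨j, hp, rfl⟩⟩
      E_refl := by
        intro p q' hp
        obtain ⟨j, hj, -⟩ :=
          (RTree.sub_fill_var (.node d us) (markVar (.node d us) qs) p q').1 hp
        exact ⟨j, hj, hj⟩
      E_symm := by
        rintro p p' ⟨j, h1, h2⟩
        exact ⟨j, h2, h1⟩
      E_trans := by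
        rintro p p' p'' ⟨j, h1, h2⟩ ⟨j', h3, h4⟩
        rw [h2] at h3
        cases h3
        exact ⟨j, h1, h4⟩ }

/-- The rule obtained from a rule of a WTA by applying `h` to its left-hand side. -/
noncomputable def homRule (h : TreeHom rkS rkD) (hne : h.Nonerasing) (r : WTARule rkS Q) :
    HRule rkD (Option Q) :=
  markRule (h r.sym) (hne r.sym) r.states r.target

/-- The rule `d(⊥, …, ⊥) → ⊥` without nontrivial constraints. -/
def sinkRule (Q : Type) (d : D) : HRule rkD (Option Q) where
  root := d
  args := fun _ => .var none
  target := none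
  E := fun p p' => p = p' ∧ ∃ q, (RTree.node (rk := rkD) d fun _ => .var (none : Option Q)).sub p
    = some (.var q)
  E_left := fun _ _ h => h.2
  E_refl := fun _ q h => ⟨rfl, q, h⟩
  E_symm := by
    rintro p p' ⟨rfl, h⟩
    exact ⟨rfl, h⟩
  E_trans := by
    rintro p p' p'' ⟨rfl, h⟩ ⟨rfl, -⟩
    exact ⟨rfl, h⟩

open Classical in
/-- The WTAh for the image of the series of `A` under `h`.  Its rules are the images of the rules
of `A`, where the weights of rules with the same image are added up, and the sink rules with
weight `1`. -/
noncomputable def imageWTAh {K : Type*} [CommSemiring K] [Finite D] (A : WTA K Q rkS)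
    (h : TreeHom rkS rkD) (hne : h.Nonerasing) : WTAh K (Option Q) rkD where
  final := A.final.map Function.Embedding.some
  rules := homRule h hne '' (A.rules : Set (WTARule rkS Q)) ∪ Set.range (sinkRule Q)
  rules_finite := (A.rules.finite_toSet.image _).union (Set.finite_range _)
  wt := fun r' =>
    match r'.target with
    | none => 1
    | some _ => ∑ r ∈ A.rules with homRule h hne r = r', A.wt r

end Image

/-! ### Inputs of algorithms -/

/-- The word that describes a tree in prefix (Polish) notation; symbols are written as
`Sum.inl s` and variables as `Sum.inr i`. -/
def RTree.prefixCode {n k : ℕ} {rk : Fin n → ℕ} : RTree rk (Fin k) → List (ℕ ⊕ ℕ)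
  | .var i => [.inr i.val]
  | .node s ts => .inl s.val :: (List.ofFn fun i => RTree.prefixCode (ts i)).flatten

/-- Descriptions of a WTA over `F` and a tree homomorphism: the ranks of the input symbols, the
ranks of the output symbols, the number of states, the list of final states, the list of weighted
rules (symbol, states, target, weight), and the list of the images of the input symbols. -/
abbrev InputCode (F : Type*) : Type _ :=
  List ℕ × List ℕ × ℕ × List ℕ × List (ℕ × List ℕ × ℕ × F) × List (List (ℕ ⊕ ℕ))

/-- `IsInputCode c A h`: `c` describes `A` and `h`, with the final states and the rules of `A`
listed in any order and without repetition. -/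
def IsInputCode {F : Type*} {m n k : ℕ} {rkS : Fin m → ℕ} {rkD : Fin n → ℕ} (c : InputCode F)
    (A : WTA F (Fin k) rkS) (h : TreeHom rkS rkD) : Prop :=
  ∃ (fs : List (Fin k)) (rs : List (WTARule rkS (Fin k))),
    fs.Nodup ∧ (∀ q, q ∈ fs ↔ q ∈ A.final) ∧ rs.Nodup ∧ (∀ r, r ∈ rs ↔ r ∈ A.rules) ∧
    c = (List.ofFn rkS, List.ofFn rkD, k, fs.map Fin.val,
      rs.map fun r => (r.sym.val, List.ofFn fun i => (r.states i).val, r.target.val, A.wt r),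
      List.ofFn fun s => RTree.prefixCode (h s))

/-! The automaton on output trees is replaced by linear algebra on input trees. A run to the sink
state uses sink rules only, so it is unique and has weight one, and a run to a proper state exists
only for trees of the form h(s). If h(s) = h(s'), then tetris-freeness gives the two root symbols
the same image, and since no variable is deleted, corresponding children have equal images as well.
Hence a run for h(σ(s_1,…,s_k)) to q amounts to a choice of states q_j admitted by a rule and of
runs for the h(s_j) to q_j (`isRun_node_iff`). The vector `imageVec` of all state weights is
therefore multilinear in the vectors of the children (`stateWeight_node`), and for a fixed input
context c the weight of h(c[s]) is a linear functional of the vector of s (`exists_linear_plug`).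

Nontrivial constraints occur in a run only at positions reached along least occurrences of
variables, and there they depend only on the image of the input symbol. So the constrained classes
do not depend on the run: they are the hole sets of images of input contexts whose hole is a
duplicated child (`class_eq_holes`). The LDP becomes the existence of such a c and some s with
h(c[s]) in the support and h(s) of height at least N (`hasLDP_iff`).

Both halves of the result then follow from linear dependence along a longest path of an input tree.
Pumping constant: if only finitely many trees fit into the context, take a fitting s of maximal
height. If its height were at least the number of states, the vectors of the subtrees on a longest
path would be dependent, and replacing one subtree by a larger one from the relation would give a
taller fitting tree (`height_lt_card_of_maximal`). Bounding heights of images by heights of inputs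
yields the constant. Decision: take a witness of minimal size and tag every subtree with the height
of its image truncated at N and with the truth value of `LargeDup`. These finitely many tags are
compatible with contexts. A dependence among subtrees of equal tag would allow a replacement by a
smaller subtree that keeps both the support and the large duplication, so minimal witnesses have
bounded height (`height_lt_of_minimal`). It remains to compute the vector, the height and the flag
of all input trees of bounded height, for which addition and multiplication in the field suffice. -/

/-! ### Filling leaves, occurrences of variables, and products over leaves. -/

namespace RTree

variable {S : Type} {rk : S → ℕ} {Z Z' Z'' : Type}

theorem fill_congr (u : RTree rk Z) {f g : List ℕ → Z → RTree rk Z'}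
    (H : ∀ p z, u.sub p = some (var z) → f p z = g p z) : u.fill f = u.fill g := by
  induction u generalizing f g with
  | var z => exact H [] z rfl
  | node s ts ih =>
    simp only [fill]
    congr 1
    funext i
    exact ih i fun p z hp => H (i :: p) z (by simp [sub, hp])

theorem eq_of_fill_eq (u : RTree rk Z) {f g : List ℕ → Z → RTree rk Z'}
    (h : u.fill f = u.fill g) {p : List ℕ} {z : Z} (hp : u.sub p = some (var z)) :
    f p z = g p z := by
  induction u generalizing f g p with
  | var z' =>
    cases p <;> simp [sub] at hp
    subst hp
    simpa [fill] using h
  | node s ts ih =>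
    cases p with
    | nil => simp [sub] at hp
    | cons i p =>
      simp only [sub] at hp
      split_ifs at hp with hi
      simp only [fill, node.injEq, heq_eq_eq, true_and] at h
      exact ih ⟨i, hi⟩ (congrFun h ⟨i, hi⟩) hp

theorem fill_fill (u : RTree rk Z) (f : List ℕ → Z → RTree rk Z')
    (g : List ℕ → Z' → RTree rk Z'') :
    (u.fill f).fill g = u.fill fun p z => (f p z).fill fun p' => g (p ++ p') := by
  induction u generalizing f g with
  | var z => simp [fill]
  | node s ts ih =>
    simp only [fill]
    congr 1
    funext i
    simpa using ih i (fun p => f (i :: p)) (fun p => g (i :: p))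

theorem subst_subst (u : RTree rk Z) (f : Z → RTree rk Z') (g : Z' → RTree rk Z'') :
    (u.subst f).subst g = u.subst fun z => (f z).subst g := fill_fill _ _ _

theorem subst_var (u : RTree rk Z) : u.subst var = u := by
  induction u with
  | var z => rfl
  | node s ts ih =>
    simp only [subst, fill] at ih ⊢
    congr 1
    funext i
    exact ih i

theorem subst_node (s : S) (ts : Fin (rk s) → RTree rk Z) (θ : Z → RTree rk Z') :
    (node s ts).subst θ = node s fun i => (ts i).subst θ := rfl

theorem subst_var_injective {g : Z → Z'} (hg : Function.Injective g) :
    Function.Injective fun u : RTree rk Z => u.subst fun z => (var (g z) : RTree rk Z') := by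
  intro u
  induction u with
  | var z =>
    rintro (z' | ⟨s, ts⟩) h
    · simp only [subst, fill, var.injEq] at h
      rw [hg h]
    · simp [subst, fill] at h
  | node s ts ih =>
    rintro (z' | ⟨s', ts'⟩) h
    · simp [subst, fill] at h
    · simp only [subst_node, node.injEq] at h
      obtain ⟨rfl, h⟩ := h
      congr 1
      funext i
      exact ih i (congrFun (eq_of_heq h) i)

@[simp] theorem sub_nil (t : RTree rk Z) : t.sub [] = some t := by
  cases t <;> rfl

theorem sub_fill_append (u : RTree rk Z) (f : List ℕ → Z → RTree rk Z') {p : List ℕ} {z : Z}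
    (hp : u.sub p = some (var z)) (v : List ℕ) : (u.fill f).sub (p ++ v) = (f p z).sub v := by
  induction u generalizing f p with
  | var z' =>
    cases p <;> simp [sub] at hp
    subst hp
    simp [fill]
  | node s ts ih =>
    cases p with
    | nil => simp [sub] at hp
    | cons i p =>
      simp only [sub] at hp
      split_ifs at hp with hi
      simpa [fill, sub, hi] using ih ⟨i, hi⟩ (fun p => f (i :: p)) hp

theorem sub_subst_append (u : RTree rk Z) (f : Z → RTree rk Z') {p : List ℕ} {z : Z}
    (hp : u.sub p = some (var z)) (v : List ℕ) : (u.subst f).sub (p ++ v) = (f z).sub v :=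
  sub_fill_append u _ hp v

/-- A variable occurrence in `u.fill f` lies below a unique variable occurrence of `u`. -/
theorem sub_fill_eq_var (u : RTree rk Z) (f : List ℕ → Z → RTree rk Z') {w : List ℕ} {y : Z'}
    (hw : (u.fill f).sub w = some (var y)) :
    ∃ p z v, u.sub p = some (var z) ∧ w = p ++ v ∧ (f p z).sub v = some (var y) := by
  induction u generalizing f w with
  | var z => exact ⟨[], z, w, rfl, rfl, hw⟩
  | node s ts ih =>
    cases w with
    | nil => simp [fill] at hw
    | cons i w =>
      simp only [fill, sub] at hw
      split_ifs at hw with hi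
      obtain ⟨p, z, v, h1, rfl, h3⟩ := ih ⟨i, hi⟩ _ hw
      exact ⟨i :: p, z, v, by simp [sub, hi, h1], rfl, h3⟩

/-- Variable occurrences are incomparable in the prefix order. -/
theorem prefix_unique (u : RTree rk Z) {p p' v v' : List ℕ} {z z' : Z}
    (hp : u.sub p = some (var z)) (hp' : u.sub p' = some (var z')) (h : p ++ v = p' ++ v') :
    p = p' ∧ z = z' ∧ v = v' := by
  induction u generalizing p p' with
  | var y =>
    cases p <;> cases p' <;> simp_all [sub]
  | node s ts ih =>
    cases p with
    | nil => simp at hp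
    | cons i p =>
      cases p' with
      | nil => simp at hp'
      | cons i' p' =>
        simp only [List.cons_append, List.cons.injEq] at h
        obtain ⟨rfl, h⟩ := h
        simp only [sub] at hp hp'
        split_ifs at hp hp' with hi
        obtain ⟨rfl, h2, h3⟩ := ih ⟨i, hi⟩ hp hp' h
        exact ⟨rfl, h2, h3⟩

theorem finite_positions (t : RTree rk Z) : t.positions.Finite := by
  induction t with
  | var z =>
    refine (Set.finite_singleton []).subset fun p hp => ?_
    cases p with
    | nil => simp
    | cons i p => simp [positions, sub] at hp
  | node s ts ih =>
    refine ((Set.finite_iUnion fun i : Fin (rk s) => (ih i).image (List.cons i.val)).insert []).subset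
      fun p hp => ?_
    cases p with
    | nil => simp
    | cons i p =>
      simp only [positions, sub, Set.mem_ofPred_eq] at hp
      split_ifs at hp with hi
      · exact .inr (Set.mem_iUnion.2 ⟨⟨i, hi⟩, p, hp, rfl⟩)
      · simp at hp

/-- `p` is the lexicographically least occurrence of `z` in `u`. -/
def IsLeastOcc (u : RTree rk Z) (z : Z) (p : List ℕ) : Prop :=
  u.sub p = some (var z) ∧ ∀ p', u.sub p' = some (var z) → p ≤ p'

theorem exists_isLeastOcc {u : RTree rk Z} {z : Z} (h : ∃ p, u.sub p = some (var z)) :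
    ∃ p, u.IsLeastOcc z p := by
  have hf : {p | u.sub p = some (var z)}.Finite :=
    u.finite_positions.subset fun p hp => by simp_all [positions]
  obtain ⟨p, hp, hm⟩ := Set.exists_min_image _ id hf h
  exact ⟨p, hp, hm⟩

theorem IsLeastOcc.eq {u : RTree rk Z} {z : Z} {p p' : List ℕ} (h : u.IsLeastOcc z p)
    (h' : u.IsLeastOcc z p') : p = p' :=
  le_antisymm (h.2 _ h'.1) (h'.2 _ h.1)

/-- The product of `f` over the leaves with variables. -/
def leafProd {K : Type*} [CommMonoid K] : RTree rk Z → (List ℕ → K) → K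
  | var _, f => f []
  | node _ ts, f => ∏ i, leafProd (ts i) fun p => f (i.val :: p)

section leafProd

variable {K : Type*} [CommMonoid K]

theorem leafProd_congr (u : RTree rk Z) {f g : List ℕ → K}
    (H : ∀ p z, u.sub p = some (var z) → f p = g p) : u.leafProd f = u.leafProd g := by
  induction u generalizing f g with
  | var z => exact H [] z rfl
  | node s ts ih =>
    exact Finset.prod_congr rfl fun i _ =>
      ih i fun p z hp => H (i :: p) z (by simp [sub, hp])

theorem leafProd_fill_var (u : RTree rk Z) (g : List ℕ → Z → Z') (f : List ℕ → K) :
    (u.fill fun p z => (var (g p z) : RTree rk Z')).leafProd f = u.leafProd f := by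
  induction u generalizing f g with
  | var z => rfl
  | node s ts ih =>
    exact Finset.prod_congr rfl fun i _ => ih i _ _

theorem leafProd_one (u : RTree rk Z) : u.leafProd (fun _ => (1 : K)) = 1 := by
  induction u with
  | var z => rfl
  | node s ts ih => exact Finset.prod_eq_one fun i _ => ih i

theorem leafProd_prod {ι : Type*} (I : Finset ι) (u : RTree rk Z) (f : ι → List ℕ → K) :
    (u.leafProd fun p => ∏ i ∈ I, f i p) = ∏ i ∈ I, u.leafProd (f i) := by
  induction u generalizing f with
  | var z => rfl
  | node s ts ih =>
    simp only [leafProd, ih]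
    exact Finset.prod_comm

theorem leafProd_ite_eq (u : RTree rk Z) {m : List ℕ} {z : Z} (hm : u.sub m = some (var z))
    (a : K) : (u.leafProd fun p => if p = m then a else 1) = a := by
  induction u generalizing m with
  | var z' =>
    cases m <;> simp_all [sub, leafProd]
  | node s ts ih =>
    cases m with
    | nil => simp at hm
    | cons i m =>
      simp only [sub] at hm
      split_ifs at hm with hi
      rw [leafProd, Finset.prod_eq_single ⟨i, hi⟩]
      · simpa using ih ⟨i, hi⟩ hm
      · intro j _ hj
        have : ∀ p, (j.val :: p = i :: m) = False := fun p => by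
          simpa using fun h => absurd (Fin.ext h) hj
        simp only [this, if_false, leafProd_one]
      · simp

/-- If only the occurrences `m j` of the variables count, the product is indexed by the
variables. -/
theorem leafProd_eq_prod {ι : Type} [Fintype ι] (u : RTree rk ι) {m : ι → List ℕ}
    (hm : ∀ j, u.sub (m j) = some (var j)) (a : ι → K) {f : List ℕ → K}
    (hf : ∀ p j, u.sub p = some (var j) → f p = if p = m j then a j else 1) :
    u.leafProd f = ∏ j, a j := by
  have : u.leafProd f = u.leafProd fun p => ∏ j, if p = m j then a j else 1 := by
    refine leafProd_congr u fun p j hp => ?_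
    rw [hf p j hp, Finset.prod_eq_single j]
    · intro j' _ hj
      refine if_neg ?_
      rintro rfl
      rw [hm] at hp
      simp at hp
      exact hj hp
    · simp
  rw [this, leafProd_prod]
  exact Finset.prod_congr rfl fun j _ => leafProd_ite_eq u (hm j) _

end leafProd

end RTree

/-! ### Shape and weight of grafted runs. -/

namespace RTree

variable {S : Type} {rk : S → ℕ} {Q Z : Type}

theorem sub_graft_append (u : RTree rk Q) (ϱ : List ℕ → RunTree rk Q) {p : List ℕ} {z : Q}
    (hp : u.sub p = some (var z)) (v : List ℕ) : (u.graft ϱ).sub (p ++ v) = (ϱ p).sub v := by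
  induction u generalizing ϱ p with
  | var z' =>
    cases p <;> simp [sub] at hp
    simp [graft]
  | node s ts ih =>
    cases p with
    | nil => simp at hp
    | cons i p =>
      simp only [sub] at hp
      split_ifs at hp with hi
      simpa [graft, sub, hi] using ih ⟨i, hi⟩ (fun p => ϱ (i :: p)) hp

/-- Inner nodes of `u` keep ordinary symbols as labels, so a label that is a rule can only come from
a grafted run. -/
theorem graft_label (u : RTree rk Q) (ϱ : List ℕ → RunTree rk Q) {w : List ℕ} {r : HRule rk Q}
    (hw : (u.graft ϱ).label w = some (.inl (.inr r))) :
    ∃ p z v, u.sub p = some (var z) ∧ w = p ++ v ∧ (ϱ p).label v = some (.inl (.inr r)) := by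
  induction u generalizing ϱ w with
  | var z => exact ⟨[], z, w, rfl, rfl, hw⟩
  | node s ts ih =>
    cases w with
    | nil => simp [graft, label, rootLabel] at hw
    | cons i w =>
      simp only [graft, label, sub] at hw
      split_ifs at hw with hi
      · obtain ⟨p, z, v, h1, rfl, h3⟩ := ih ⟨i, hi⟩ _ hw
        exact ⟨i :: p, z, v, by simpa [sub] using ⟨hi, h1⟩, rfl, h3⟩
      · simp at hw

theorem graft_congr (u : RTree rk Q) {ϱ ϱ' : List ℕ → RunTree rk Q}
    (H : ∀ p z, u.sub p = some (var z) → ϱ p = ϱ' p) : u.graft ϱ = u.graft ϱ' := by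
  induction u generalizing ϱ ϱ' with
  | var z => exact H [] z rfl
  | node s ts ih =>
    simp only [graft]
    congr 1
    funext i
    exact ih i fun p z hp => H (i :: p) z (by simpa [sub] using ⟨i.2, hp⟩)

theorem eq_of_graft_eq (u : RTree rk Q) {ϱ ϱ' : List ℕ → RunTree rk Q}
    (h : u.graft ϱ = u.graft ϱ') {p : List ℕ} {z : Q} (hp : u.sub p = some (var z)) :
    ϱ p = ϱ' p := by
  induction u generalizing ϱ ϱ' p with
  | var z' =>
    cases p <;> simp [sub] at hp
    simpa [graft] using h
  | node s ts ih =>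
    cases p with
    | nil => simp [sub] at hp
    | cons i p =>
      simp only [sub] at hp
      split_ifs at hp with hi
      simp only [graft, node.injEq, heq_eq_eq, true_and] at h
      exact ih ⟨i, hi⟩ (congrFun h ⟨i, hi⟩) hp

theorem weight_graft {K : Type*} [CommSemiring K] (M : WTAh K Q rk) (u : RTree rk Q)
    (ϱ : List ℕ → RunTree rk Q) : M.weight (u.graft ϱ) = u.leafProd fun p => M.weight (ϱ p) := by
  induction u generalizing ϱ with
  | var z => rfl
  | node s ts ih =>
    simp only [graft, WTAh.weight, leafProd, Sum.elim_inl, one_mul]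
    exact Finset.prod_congr rfl fun i _ => ih i _

end RTree

namespace HRule

variable {S : Type} {rk : S → ℕ} {Q : Type}

open RTree

theorem sub_graft_append (r : HRule rk Q) (ϱ : List ℕ → RunTree rk Q) {p : List ℕ} {z : Q}
    (hp : r.lhs.sub p = some (var z)) (v : List ℕ) : (r.graft ϱ).sub (p ++ v) = (ϱ p).sub v := by
  cases p with
  | nil => simp [lhs] at hp
  | cons i p =>
    simp only [lhs, sub] at hp
    split_ifs at hp with hi
    simpa [graft, sub, hi] using RTree.sub_graft_append _ (fun p => ϱ (i :: p)) hp v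

theorem graft_label (r : HRule rk Q) (ϱ : List ℕ → RunTree rk Q) {w : List ℕ} {r' : HRule rk Q}
    (hw : (r.graft ϱ).label w = some (.inl (.inr r'))) :
    w = [] ∧ r' = r ∨
      ∃ p z v, r.lhs.sub p = some (var z) ∧ w = p ++ v ∧
        (ϱ p).label v = some (.inl (.inr r')) := by
  cases w with
  | nil =>
    refine .inl ⟨rfl, ?_⟩
    simpa [graft, label, rootLabel, eq_comm] using hw
  | cons i w =>
    simp only [graft, label, sub] at hw
    split_ifs at hw with hi
    · obtain ⟨p, z, v, h1, rfl, h3⟩ := RTree.graft_label _ _ hw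
      exact .inr ⟨i :: p, z, v, by simpa [lhs, sub] using ⟨hi, h1⟩, rfl, h3⟩
    · simp at hw

theorem graft_congr (r : HRule rk Q) {ϱ ϱ' : List ℕ → RunTree rk Q}
    (H : ∀ p z, r.lhs.sub p = some (var z) → ϱ p = ϱ' p) : r.graft ϱ = r.graft ϱ' := by
  simp only [graft]
  congr 1
  funext i
  exact RTree.graft_congr _ fun p z hp => H (i :: p) z (by simpa [lhs, sub] using ⟨i.2, hp⟩)

/-- The rule is the root label and the subruns sit at known positions. Counting runs by their pieces
rests on this unique decomposition. -/
theorem graft_inj {r r' : HRule rk Q} {ϱ ϱ' : List ℕ → RunTree rk Q}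
    (h : r.graft ϱ = r'.graft ϱ') :
    r = r' ∧ ∀ p z, r.lhs.sub p = some (var z) → ϱ p = ϱ' p := by
  have hr : r = r' := by
    have := congrArg rootLabel h
    simpa [graft, rootLabel] using this
  subst hr
  refine ⟨rfl, fun p z hp => ?_⟩
  cases p with
  | nil => simp [lhs] at hp
  | cons i p =>
    simp only [lhs, sub] at hp
    split_ifs at hp with hi
    simp only [graft, node.injEq, heq_eq_eq, true_and] at h
    exact RTree.eq_of_graft_eq _ (congrFun h ⟨i, hi⟩) hp

theorem weight_graft {K : Type*} [CommSemiring K] (M : WTAh K Q rk) (r : HRule rk Q)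
    (ϱ : List ℕ → RunTree rk Q) :
    M.weight (r.graft ϱ) = M.wt r * r.lhs.leafProd fun p => M.weight (ϱ p) := by
  simp only [graft, lhs, WTAh.weight, leafProd, Sum.elim_inr]
  congr 1
  exact Finset.prod_congr rfl fun i _ => RTree.weight_graft _ _ _

end HRule

/-! ### The rules that come from images of symbols. -/

section MarkRule

variable {D : Type} {rkD : D → ℕ} {Q : Type} {k : ℕ}

open RTree

/-- `markRule` is defined by a match on `u`, so its fields do not reduce for a general tree. This
equation and the next two replace unfolding. -/
theorem markRule_lhs (u : RTree rkD (Fin k)) (hu : ∀ i, u ≠ .var i) (qs : Fin k → Q) (q : Q) :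
    (markRule u hu qs q).lhs = u.fill fun p j => .var (markVar u qs p j) := by
  cases u with
  | var i => exact absurd rfl (hu i)
  | node d us => rfl

theorem markRule_target (u : RTree rkD (Fin k)) (hu : ∀ i, u ≠ .var i) (qs : Fin k → Q) (q : Q) :
    (markRule u hu qs q).target = some q := by
  cases u with
  | var i => exact absurd rfl (hu i)
  | node d us => rfl

theorem markRule_E (u : RTree rkD (Fin k)) (hu : ∀ i, u ≠ .var i) (qs : Fin k → Q) (q : Q)
    (p p' : List ℕ) :
    (markRule u hu qs q).E p p' ↔ ∃ j, u.sub p = some (.var j) ∧ u.sub p' = some (.var j) := by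
  cases u with
  | var i => exact absurd rfl (hu i)
  | node d us => rfl

theorem markVar_of_isLeastOcc {u : RTree rkD (Fin k)} (qs : Fin k → Q) {p : List ℕ} {j : Fin k}
    (hp : u.IsLeastOcc j p) : markVar u qs p j = some (qs j) :=
  if_pos hp.2

theorem markVar_of_not_isLeastOcc {u : RTree rkD (Fin k)} (qs : Fin k → Q) {p : List ℕ}
    {j : Fin k} (hj : u.sub p = some (.var j)) (hp : ¬ u.IsLeastOcc j p) :
    markVar u qs p j = none :=
  if_neg fun h => hp ⟨hj, h⟩

theorem markRule_lhs_sub (u : RTree rkD (Fin k)) (hu : ∀ i, u ≠ .var i) (qs : Fin k → Q) (q : Q)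
    {p : List ℕ} {j : Fin k} (hj : u.sub p = some (.var j)) :
    (markRule u hu qs q).lhs.sub p = some (.var (markVar u qs p j)) := by
  rw [markRule_lhs, sub_fill_var]
  exact ⟨j, hj, rfl⟩

theorem markRule_lhs_sub_iff (u : RTree rkD (Fin k)) (hu : ∀ i, u ≠ .var i) (qs : Fin k → Q)
    (q : Q) {p : List ℕ} {z : Option Q} : (markRule u hu qs q).lhs.sub p = some (.var z) ↔
      ∃ j, u.sub p = some (.var j) ∧ markVar u qs p j = z := by
  rw [markRule_lhs, sub_fill_var]

/-- Each state can be read off at the least occurrence of its variable, which exists because no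
variable is deleted. -/
theorem markRule_inj {u : RTree rkD (Fin k)} (hu : ∀ i, u ≠ .var i)
    (hd : ∀ j, ∃ p, u.sub p = some (.var j)) {qs qs' : Fin k → Q} {q q' : Q}
    (h : markRule u hu qs q = markRule u hu qs' q') : qs = qs' ∧ q = q' := by
  refine ⟨?_, ?_⟩
  · funext j
    obtain ⟨p, hp⟩ := exists_isLeastOcc (hd j)
    have h1 := markRule_lhs_sub u hu qs q hp.1
    have h2 := markRule_lhs_sub u hu qs' q' hp.1
    rw [h, h2, markVar_of_isLeastOcc qs hp, markVar_of_isLeastOcc qs' hp] at h1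
    simpa using h1.symm
  · have := congrArg HRule.target h
    simpa [markRule_target] using this

end MarkRule

/-! ### The sink state and its runs. -/

section Sink

variable {D : Type} {rkD : D → ℕ} {Q : Type}

open RTree

/-- The run for `t` that uses the sink rules only. -/
def sinkRun (Q : Type) : RTree rkD Empty → RunTree rkD (Option Q)
  | .var e => e.elim
  | .node d ts => .node (.inr (sinkRule Q d)) fun i => sinkRun Q (ts i)

theorem sinkRule_graft (d : D) (ϱ : List ℕ → RunTree rkD (Option Q)) :
    (sinkRule Q d).graft ϱ = .node (.inr (sinkRule Q d)) fun i => ϱ [i.val] := rfl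

theorem sinkRule_lhs_fill (d : D) (t : List ℕ → RTree rkD Empty) :
    ((sinkRule Q d).lhs.fill fun p _ => t p) = .node d fun i => t [i.val] := rfl

theorem sinkRule_lhs_sub {d : D} {p : List ℕ} {q : Option Q} :
    (sinkRule (rkD := rkD) Q d).lhs.sub p = some (.var q) ↔
      ∃ i : Fin (rkD d), p = [i.val] ∧ q = none := by
  constructor
  · intro h
    rcases p with _ | ⟨i, p⟩
    · simp [HRule.lhs] at h
    · simp only [HRule.lhs, sinkRule, sub] at h
      split_ifs at h with hi
      cases p with
      | nil => simp at h; exact ⟨⟨i, hi⟩, rfl, h.symm⟩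
      | cons => simp [sub] at h
  · rintro ⟨i, rfl, rfl⟩
    have := i.2
    simp [HRule.lhs, sinkRule, sub]

theorem sinkRun_label (t : RTree rkD Empty) {p : List ℕ} {r : HRule rkD (Option Q)}
    (h : (sinkRun Q t).label p = some (.inl (.inr r))) : ∃ d, r = sinkRule Q d := by
  induction t generalizing p with
  | var e => exact e.elim
  | node d ts ih =>
    cases p with
    | nil =>
      simp only [sinkRun, label, sub_nil, Option.map_some, rootLabel, Option.some.injEq,
        Sum.inl.injEq, Sum.inr.injEq] at h
      exact ⟨d, h.symm⟩
    | cons i p =>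
      simp only [label, sinkRun, sub] at h
      split_ifs at h with hi
      · exact ih ⟨i, hi⟩ h
      · simp at h

end Sink

open RTree

/-! ### Consequences of tetris-freeness for symbols with the same image. -/

namespace TreeHom

variable {S D : Type} {rkS : S → ℕ} {rkD : D → ℕ}

theorem apply_node (h : TreeHom rkS rkD) (s : S) (ss : Fin (rkS s) → RTree rkS Empty) :
    h.apply (.node s ss) = RTree.subst (h s) fun i => h.apply (ss i) := by
  simp [apply]

theorem symbolImage_sub (h : TreeHom rkS rkD) (s : S) {p : List ℕ} {j : ℕ} :
    (h.symbolImage s).sub p = some (.var j) ↔ ∃ i : Fin (rkS s), RTree.sub (h s) p = some (.var i) ∧ i.val = j :=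
  RTree.sub_fill_var (h s) (fun _ (i : Fin (rkS s)) => i.val) p j

/-- Without deletion the rank is visible in the image: if `b` had smaller rank, the variable with
index `rkS b` would occur in the image of `a` but could not occur in that of `b`. -/
theorem Nondeleting.rank_le {h : TreeHom rkS rkD} (hd : h.Nondeleting) {a b : S}
    (e : h.symbolImage a = h.symbolImage b) : rkS a ≤ rkS b := by
  by_contra! hlt
  obtain ⟨p, hp⟩ := hd a ⟨rkS b, hlt⟩
  have := (h.symbolImage_sub a).2 ⟨_, hp, rfl⟩
  rw [e, symbolImage_sub] at this
  obtain ⟨i, -, hi⟩ := this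
  exact i.2.ne hi

/-- Symbols with the same image have images that are equal as trees over the same variables. -/
theorem Nondeleting.sigma_eq {h : TreeHom rkS rkD} (hd : h.Nondeleting) {a b : S}
    (e : h.symbolImage a = h.symbolImage b) :
    (⟨rkS a, h a⟩ : Σ k, RTree rkD (Fin k)) = ⟨rkS b, h b⟩ := by
  have hk : rkS a = rkS b := le_antisymm (hd.rank_le e) (hd.rank_le e.symm)
  -- Stated for arbitrary ranks, so that their equality can be eliminated; `rkS a = rkS b` itself
  -- cannot be substituted.
  have key : ∀ {k k' : ℕ} (u : RTree rkD (Fin k)) (u' : RTree rkD (Fin k')), k = k' →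
      (u.subst fun i => (.var i.val : RTree rkD ℕ)) = u'.subst (fun i => .var i.val) →
      (⟨k, u⟩ : Σ k, RTree rkD (Fin k)) = ⟨k', u'⟩ := by
    rintro k _ u u' rfl hu
    rw [subst_var_injective Fin.val_injective hu]
  exact key _ _ hk e

theorem TetrisFree.root_eq {h : TreeHom rkS rkD} (hT : h.TetrisFree) {a b : S}
    {ss : Fin (rkS a) → RTree rkS Empty} {ss' : Fin (rkS b) → RTree rkS Empty}
    (e : h.apply (.node a ss) = h.apply (.node b ss')) : h.symbolImage a = h.symbolImage b :=
  hT.image_eq _ _ e [] a b (by simp [label, rootLabel]) (by simp [label, rootLabel])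

/-- Symbols whose images agree up to a renaming of the variables have the same image, if there are
ground trees at all. -/
theorem TetrisFree.symbolImage_eq_of_shape {h : TreeHom rkS rkD} (hT : h.TetrisFree) {a b : S}
    (s : RTree rkS Empty)
    (e : (RTree.subst (h a) fun _ => h.apply s) = RTree.subst (h b) fun _ => h.apply s) :
    h.symbolImage a = h.symbolImage b := by
  refine hT.root_eq (ss := fun _ => s) (ss' := fun _ => s) ?_
  rw [apply_node, apply_node, e]

end TreeHom

/-! ### Runs for images of input trees. -/

section Spread

variable {D : Type} {rkD : D → ℕ} {Q : Type}

open Classical in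
/-- The run `ϱs j` at the least occurrence of the variable `j`, and the sink run for `ts j` at all
others. -/
noncomputable def spread {k : ℕ} (u : RTree rkD (Fin k)) (ϱs : Fin k → RunTree rkD (Option Q))
    (ts : Fin k → RTree rkD Empty) (d : RunTree rkD (Option Q)) (p : List ℕ) :
    RunTree rkD (Option Q) :=
  match u.sub p with
  | some (.var j) => if u.IsLeastOcc j p then ϱs j else sinkRun Q (ts j)
  | _ => d

section spread

variable {k : ℕ} {u : RTree rkD (Fin k)} {ϱs : Fin k → RunTree rkD (Option Q)}
  {ts : Fin k → RTree rkD Empty} {d : RunTree rkD (Option Q)} {p : List ℕ} {j : Fin k}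

theorem spread_of_isLeastOcc (hp : u.IsLeastOcc j p) : spread u ϱs ts d p = ϱs j := by
  simp only [spread, hp.1]
  exact if_pos hp

theorem spread_of_not_isLeastOcc (hj : u.sub p = some (.var j)) (hp : ¬ u.IsLeastOcc j p) :
    spread u ϱs ts d p = sinkRun Q (ts j) := by
  simp only [spread, hj]
  exact if_neg hp

end spread

end Spread

section Runs

variable {S D : Type} {rkS : S → ℕ} {rkD : D → ℕ} {Q : Type}

theorem homRule_target {h : TreeHom rkS rkD} {hne : h.Nonerasing} (r : WTARule rkS Q) :
    (homRule h hne r).target = some r.target :=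
  markRule_target _ _ _ _

variable {K : Type*} [CommSemiring K] {A : WTA K Q rkS} {h : TreeHom rkS rkD}
  {hne : h.Nonerasing} [Finite D]

theorem mem_imageWTAh_rules {r' : HRule rkD (Option Q)} :
    r' ∈ (imageWTAh A h hne).rules ↔
      (∃ r ∈ A.rules, homRule h hne r = r') ∨ ∃ d, sinkRule Q d = r' := by
  simp [imageWTAh]

theorem imageWTAh_wt_sinkRule (d : D) : (imageWTAh A h hne).wt (sinkRule Q d) = 1 := rfl

open Classical in
theorem imageWTAh_wt_of_target {r' : HRule rkD (Option Q)} {q : Q} (hq : r'.target = some q) :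
    (imageWTAh A h hne).wt r' = ∑ r ∈ A.rules with homRule h hne r = r', A.wt r := by
  simp only [imageWTAh, hq]

theorem weight_sinkRun (t : RTree rkD Empty) : (imageWTAh A h hne).weight (sinkRun Q t) = 1 := by
  induction t with
  | var e => exact e.elim
  | node d ts ih =>
    simp only [sinkRun, WTAh.weight, Sum.elim_inr, imageWTAh_wt_sinkRule, one_mul]
    exact Finset.prod_eq_one fun i _ => ih i

/-- Images of rules of `A` have proper targets, so only sink rules lead to the sink, and the sink
rule at each node is dictated by the symbol there. -/
theorem isRun_none {ϱ : RunTree rkD (Option Q)} {t : RTree rkD Empty} :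
    (imageWTAh A h hne).IsRun ϱ t none ↔ ϱ = sinkRun Q t := by
  constructor
  · intro hrun
    generalize hq : (none : Option Q) = q at hrun
    induction hrun with
    | step r hr ϱ t hrun hE ih =>
      rcases mem_imageWTAh_rules.1 hr with ⟨r, hr, rfl⟩ | ⟨d, rfl⟩
      · simp [homRule_target] at hq
      · rw [sinkRule_graft, sinkRule_lhs_fill, sinkRun]
        congr 1
        funext i
        exact ih [i.val] none (sinkRule_lhs_sub.2 ⟨i, rfl, rfl⟩) rfl
  · rintro rfl
    induction t with
    | var e => exact e.elim
    | node d ts ih =>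
      -- `IsRun.step` wants trees for all words; only the words `[i]` matter, and elsewhere the
      -- value is arbitrary.
      let t' : List ℕ → RTree rkD Empty := fun p =>
        if hp : p.headI < rkD d then ts ⟨p.headI, hp⟩ else .node d ts
      have ht' : ∀ i : Fin (rkD d), t' [i.val] = ts i := fun i => dif_pos i.2
      have := WTAh.IsRun.step (M := imageWTAh A h hne) (sinkRule Q d)
        (mem_imageWTAh_rules.2 (.inr ⟨d, rfl⟩)) (fun p => sinkRun Q (t' p)) t' ?_ ?_
      · rw [sinkRule_graft, sinkRule_lhs_fill] at this
        simp only [ht'] at this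
        have e : (sinkRule Q d).graft (fun p => sinkRun Q (t' p)) = sinkRun Q (.node d ts) := by
          rw [sinkRule_graft, sinkRun]
          congr 1
          funext i
          exact congrArg _ (ht' i)
        rw [← e]
        exact this
      · intro p q hp
        obtain ⟨i, rfl, rfl⟩ := sinkRule_lhs_sub.1 hp
        simpa only [ht'] using ih i
      · rintro p p' ⟨rfl, -⟩
        rfl

theorem isRun_graft_spread {k : ℕ} {u : RTree rkD (Fin k)} (hu : ∀ i, u ≠ .var i)
    {qs : Fin k → Q} {q : Q} (hr : markRule u hu qs q ∈ (imageWTAh A h hne).rules)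
    {ϱs : Fin k → RunTree rkD (Option Q)} {ts : Fin k → RTree rkD Empty}
    (hrun : ∀ j, (imageWTAh A h hne).IsRun (ϱs j) (ts j) (some (qs j)))
    (d : RunTree rkD (Option Q)) :
    (imageWTAh A h hne).IsRun ((markRule u hu qs q).graft (spread u ϱs ts d)) (u.subst ts)
      (some q) := by
  classical
  let t' : List ℕ → RTree rkD Empty := fun p =>
    match u.sub p with
    | some (.var j) => ts j
    | _ => u.subst ts
  have ht' : ∀ {p j}, u.sub p = some (.var j) → t' p = ts j := fun hp => by simp only [t', hp]
  have := WTAh.IsRun.step (markRule u hu qs q) hr (spread u ϱs ts d) t' ?_ ?_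
  · rw [markRule_target] at this
    convert this using 1
    rw [markRule_lhs, fill_fill]
    exact fill_congr u fun p j hp => by simp [fill, ht' hp]
  · intro p z hp
    obtain ⟨j, hj, rfl⟩ := (markRule_lhs_sub_iff u hu qs q).1 hp
    by_cases hl : u.IsLeastOcc j p
    · rw [spread_of_isLeastOcc hl, markVar_of_isLeastOcc qs hl, ht' hj]
      exact hrun j
    · rw [spread_of_not_isLeastOcc hj hl, markVar_of_not_isLeastOcc qs hj hl, ht' hj, isRun_none]
  · intro p p' hE
    obtain ⟨j, h1, h2⟩ := (markRule_E u hu qs q p p').1 hE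
    rw [ht' h1, ht' h2]

/-- A proper target forces the image of a rule of `A` at the root. Induction finds preimages at the
least occurrences, and the constraints carry them to all other occurrences, where the run is the
sink run. The last argument of `spread` is a value at positions without a variable and has no
influence on the graft. -/
theorem isRun_some_inv (hd : h.Nondeleting) {ϱ : RunTree rkD (Option Q)} {t : RTree rkD Empty}
    {q : Q} (hrun : (imageWTAh A h hne).IsRun ϱ t (some q)) :
    ∃ r ∈ A.rules, r.target = q ∧
      ∃ (ss : Fin (rkS r.sym) → RTree rkS Empty) (ϱs : Fin (rkS r.sym) → RunTree rkD (Option Q)),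
        (∀ j, (imageWTAh A h hne).IsRun (ϱs j) (h.apply (ss j)) (some (r.states j))) ∧
        t = h.apply (.node r.sym ss) ∧
        ϱ = (homRule h hne r).graft
          (spread (h r.sym) ϱs (fun j => h.apply (ss j)) (sinkRun Q t)) := by
  generalize hq : some q = q' at hrun
  induction hrun generalizing q with
  | step r' hr' ϱ t hrun hE ih =>
    rcases mem_imageWTAh_rules.1 hr' with ⟨r, hr, rfl⟩ | ⟨d, rfl⟩
    swap
    · simp [sinkRule] at hq
    choose m hm using fun j => exists_isLeastOcc (hd r.sym j)
    have hsub : ∀ {p j}, RTree.sub (h r.sym) p = some (.var j) →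
        (homRule h hne r).lhs.sub p = some (.var (markVar (h r.sym) r.states p j)) :=
      fun hp => markRule_lhs_sub _ _ _ _ hp
    have hsubm : ∀ j, (homRule h hne r).lhs.sub (m j) = some (.var (some (r.states j))) :=
      fun j => by rw [hsub (hm j).1, markVar_of_isLeastOcc _ (hm j)]
    have hs : ∀ j, ∃ s, t (m j) = h.apply s := fun j => by
      obtain ⟨r1, -, -, ss, -, -, h1, -⟩ := ih (m j) _ (hsubm j) rfl
      exact ⟨_, h1⟩
    choose ss hss using hs
    -- At other occurrences the state is the sink, about which the induction hypothesis says
    -- nothing; the constraint with the least occurrence `m j` supplies the equality.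
    have ht : ∀ {p j}, RTree.sub (h r.sym) p = some (.var j) → t p = h.apply (ss j) :=
      fun {p j} hp => by
        rw [hE p (m j) ((markRule_E _ _ _ _ _ _).2 ⟨j, hp, (hm j).1⟩), hss]
    refine ⟨r, hr, ?_, ss, fun j => ϱ (m j), fun j => ?_, ?_, ?_⟩
    · simpa [homRule_target] using hq.symm
    · rw [← hss]
      exact hrun _ _ (hsubm j)
    · rw [TreeHom.apply_node, homRule, markRule_lhs, fill_fill]
      exact fill_congr _ fun p j hp => by simp [fill, ht hp]
    · refine HRule.graft_congr _ fun p z hp => ?_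
      obtain ⟨j, hj, rfl⟩ := (markRule_lhs_sub_iff _ _ _ _).1 hp
      by_cases hl : (h r.sym).IsLeastOcc j p
      · rw [spread_of_isLeastOcc hl, (hm j).eq hl]
      · rw [spread_of_not_isLeastOcc hj hl, ← ht hj]
        have := hrun p _ hp
        rwa [markVar_of_not_isLeastOcc _ hj hl, isRun_none] at this

theorem exists_preimage_of_isRun (hd : h.Nondeleting) {ϱ : RunTree rkD (Option Q)}
    {t : RTree rkD Empty} {q : Q} (hrun : (imageWTAh A h hne).IsRun ϱ t (some q)) :
    ∃ s, t = h.apply s := by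
  obtain ⟨r, -, -, ss, -, -, h1, -⟩ := isRun_some_inv hd hrun
  exact ⟨_, h1⟩

/-- The run may have been built from another symbol and other children with the same image.
Tetris-freeness makes the two symbol images equal, so the rule used is also a rule marked on `h σ`,
and the images of the children agree as well. -/
theorem isRun_node_iff (hT : h.TetrisFree) {σ : S} {ss : Fin (rkS σ) → RTree rkS Empty} {q : Q}
    {ϱ : RunTree rkD (Option Q)} :
    (imageWTAh A h hT.nonerasing).IsRun ϱ (h.apply (.node σ ss)) (some q) ↔
      ∃ (qs : Fin (rkS σ) → Q) (ϱs : Fin (rkS σ) → RunTree rkD (Option Q)),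
        markRule (h σ) (hT.nonerasing σ) qs q ∈ (imageWTAh A h hT.nonerasing).rules ∧
        (∀ j, (imageWTAh A h hT.nonerasing).IsRun (ϱs j) (h.apply (ss j)) (some (qs j))) ∧
        ϱ = (markRule (h σ) (hT.nonerasing σ) qs q).graft
          (spread (h σ) ϱs (fun j => h.apply (ss j)) (sinkRun Q (h.apply (.node σ ss)))) := by
  constructor
  · intro hrun
    obtain ⟨r, hr, rfl, ss', ϱs, h1, h2, h3⟩ := isRun_some_inv hT.nondeleting hrun
    have hr' : homRule h hT.nonerasing r ∈ (imageWTAh A h hT.nonerasing).rules :=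
      mem_imageWTAh_rules.2 (.inl ⟨r, hr, rfl⟩)
    have hsig := hT.nondeleting.sigma_eq (hT.root_eq h2)
    rw [TreeHom.apply_node, TreeHom.apply_node] at h2
    -- Rank and image of `r.sym` are generalized together, since the states and subruns have types
    -- that depend on the rank.
    have key : ∀ (k : ℕ) (u : RTree rkD (Fin k)) (hu : ∀ i, u ≠ .var i)
        (_ : (⟨rkS σ, h σ⟩ : Σ k, RTree rkD (Fin k)) = ⟨k, u⟩) (qs : Fin k → Q)
        (ts : Fin k → RTree rkD Empty) (ϱs : Fin k → RunTree rkD (Option Q))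
        (_ : (RTree.subst (h σ) fun i => h.apply (ss i)) = u.subst ts)
        (_ : markRule u hu qs r.target ∈ (imageWTAh A h hT.nonerasing).rules)
        (_ : ∀ j, (imageWTAh A h hT.nonerasing).IsRun (ϱs j) (ts j) (some (qs j))),
        ∃ (qs' : Fin (rkS σ) → Q) (ϱs' : Fin (rkS σ) → RunTree rkD (Option Q)),
          markRule (h σ) (hT.nonerasing σ) qs' r.target ∈ (imageWTAh A h hT.nonerasing).rules ∧
          (∀ j, (imageWTAh A h hT.nonerasing).IsRun (ϱs' j) (h.apply (ss j)) (some (qs' j))) ∧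
          (markRule u hu qs r.target).graft
              (spread u ϱs ts (sinkRun Q (h.apply (.node σ ss)))) =
            (markRule (h σ) (hT.nonerasing σ) qs' r.target).graft
              (spread (h σ) ϱs' (fun j => h.apply (ss j)) (sinkRun Q (h.apply (.node σ ss)))) := by
      rintro _ _ hu ⟨⟩ qs ts ϱs e hr hrun
      have hss : (fun j => h.apply (ss j)) = ts := funext fun j =>
        let ⟨p, hp⟩ := hT.nondeleting σ j
        eq_of_fill_eq (h σ) e hp
      subst hss
      exact ⟨qs, ϱs, hr, hrun, rfl⟩
    obtain ⟨qs', ϱs', k1, k2, k3⟩ := key _ (h r.sym) (hT.nonerasing r.sym) hsig r.states _ ϱs h2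
      hr' h1
    exact ⟨qs', ϱs', k1, k2, h3.trans k3⟩
  · rintro ⟨qs, ϱs, hr, hrun, rfl⟩
    rw [TreeHom.apply_node]
    exact isRun_graft_spread _ hr hrun _

end Runs

/-- Putting one fixed ground tree at all state leaves erases the states, so equal rules give equal
images of two input trees with constant children, and tetris-freeness applies to their roots. This
is where a ground tree is needed. -/
theorem symbolImage_eq_of_homRule_eq {S D Q : Type} {rkS : S → ℕ} {rkD : D → ℕ}
    {h : TreeHom rkS rkD} (hT : h.TetrisFree) {r : WTARule rkS Q} {σ : S}
    {qs : Fin (rkS σ) → Q} {q : Q} (s : RTree rkS Empty)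
    (e : homRule h hT.nonerasing r = markRule (h σ) (hT.nonerasing σ) qs q) :
    h.symbolImage r.sym = h.symbolImage σ := by
  refine hT.symbolImage_eq_of_shape s ?_
  have key : ∀ {k : ℕ} (u : RTree rkD (Fin k)) (hu : ∀ i, u ≠ .var i) (qs : Fin k → Q) (q : Q),
      (markRule u hu qs q).lhs.subst (fun _ => h.apply s) = u.subst fun _ => h.apply s :=
    fun u hu qs q => by
      rw [markRule_lhs, subst, fill_fill]
      rfl
  rw [← key _ (hT.nonerasing _) r.states r.target, ← key _ (hT.nonerasing _) qs q, ← e]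
  rfl

/-! ### The recursion for the state weights. -/

section Weights

variable {S D : Type} {rkS : S → ℕ} {rkD : D → ℕ} {Q : Type} [Finite D]
variable {K : Type*} [CommSemiring K] {A : WTA K Q rkS} {h : TreeHom rkS rkD}

/-- Needed to turn the `finsum` in `stateWeight` into an honest finite sum over all runs. -/
theorem finite_runs [Finite Q] (hT : h.TetrisFree) (s : RTree rkS Empty) (q : Q) :
    {ϱ | (imageWTAh A h hT.nonerasing).IsRun ϱ (h.apply s) (some q)}.Finite := by
  induction s generalizing q with
  | var e => exact e.elim
  | node σ ss ih =>
    refine (Set.finite_iUnion fun qs : Fin (rkS σ) → Q =>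
      (Set.Finite.pi' fun j => ih j (qs j)).image fun ϱs =>
        (markRule (h σ) (hT.nonerasing σ) qs q).graft
          (spread (h σ) ϱs (fun j => h.apply (ss j)) (sinkRun Q (h.apply (.node σ ss))))).subset
      fun ϱ hϱ => ?_
    obtain ⟨qs, ϱs, -, h2, rfl⟩ := (isRun_node_iff hT).1 hϱ
    exact Set.mem_iUnion.2 ⟨qs, ϱs, h2, rfl⟩

/-- Sink runs have weight one, so every variable contributes exactly once, at its least occurrence,
however often it is duplicated. -/
theorem weight_graft_spread {hne : h.Nonerasing} {k : ℕ} {u : RTree rkD (Fin k)}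
    (hu : ∀ i, u ≠ .var i) (hd : ∀ j, ∃ p, u.sub p = some (.var j)) (qs : Fin k → Q) (q : Q)
    (ϱs : Fin k → RunTree rkD (Option Q)) (ts : Fin k → RTree rkD Empty)
    (d : RunTree rkD (Option Q)) :
    (imageWTAh A h hne).weight ((markRule u hu qs q).graft (spread u ϱs ts d)) =
      (imageWTAh A h hne).wt (markRule u hu qs q) *
        ∏ j, (imageWTAh A h hne).weight (ϱs j) := by
  choose m hm using fun j => exists_isLeastOcc (hd j)
  rw [HRule.weight_graft, markRule_lhs, leafProd_fill_var]
  congr 1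
  refine leafProd_eq_prod u (fun j => (hm j).1) _ fun p j hp => ?_
  split_ifs with hpm
  · rw [spread_of_isLeastOcc (hpm ▸ hm j)]
  · rw [spread_of_not_isLeastOcc hp fun hl => hpm (hl.eq (hm j)), weight_sinkRun]

theorem mem_rules_of_wt_ne_zero {hne : h.Nonerasing} {r' : HRule rkD (Option Q)} {q : Q}
    (hq : r'.target = some q) (hw : (imageWTAh A h hne).wt r' ≠ 0) :
    r' ∈ (imageWTAh A h hne).rules := by
  classical
  rw [imageWTAh_wt_of_target hq] at hw
  obtain ⟨r, hr, -⟩ := Finset.exists_ne_zero_of_sum_ne_zero hw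
  exact mem_imageWTAh_rules.2 (.inl ⟨r, Finset.mem_filter.1 hr⟩)

theorem series_eq_sum {hne : h.Nonerasing} (t : RTree rkD Empty) :
    (imageWTAh A h hne).series t =
      ∑ q ∈ A.final, (imageWTAh A h hne).stateWeight t (some q) := by
  simp [WTAh.series, imageWTAh]

variable [Fintype Q]

/-- Runs for the whole tree are in bijection with pairs of an admissible state tuple and a family of
subruns; distributivity turns the sum over families into a product of sums. The result is
multilinear in the weight vectors of the children. -/
theorem stateWeight_node (hT : h.TetrisFree) (σ : S) (ss : Fin (rkS σ) → RTree rkS Empty)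
    (q : Q) :
    (imageWTAh A h hT.nonerasing).stateWeight (h.apply (.node σ ss)) (some q) =
      ∑ qs : Fin (rkS σ) → Q,
        (imageWTAh A h hT.nonerasing).wt (markRule (h σ) (hT.nonerasing σ) qs q) *
          ∏ j, (imageWTAh A h hT.nonerasing).stateWeight (h.apply (ss j)) (some (qs j)) := by
  classical
  let M := imageWTAh A h hT.nonerasing
  let R : ∀ j : Fin (rkS σ), Q → Finset (RunTree rkD (Option Q)) := fun j q' =>
    (finite_runs (A := A) hT (ss j) q').toFinset
  let r : (Fin (rkS σ) → Q) → HRule rkD (Option Q) := fun qs =>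
    markRule (h σ) (hT.nonerasing σ) qs q
  let build : (Σ _ : Fin (rkS σ) → Q, Fin (rkS σ) → RunTree rkD (Option Q)) →
      RunTree rkD (Option Q) := fun x => (r x.1).graft
        (spread (h σ) x.2 (fun j => h.apply (ss j)) (sinkRun Q (h.apply (.node σ ss))))
  let I : Finset (Σ _ : Fin (rkS σ) → Q, Fin (rkS σ) → RunTree rkD (Option Q)) :=
    (Finset.univ.filter fun qs => r qs ∈ M.rules).sigma fun qs =>
      Fintype.piFinset fun j => R j (qs j)
  have hI : {ϱ | M.IsRun ϱ (h.apply (.node σ ss)) (some q)} = ↑(I.image build) := by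
    ext ϱ
    simp only [Set.mem_ofPred_eq, isRun_node_iff hT, M, Finset.coe_image, Set.mem_image,
      Finset.mem_coe, I, Finset.mem_sigma, Finset.mem_filter, Finset.mem_univ, true_and,
      Fintype.mem_piFinset, R, Set.Finite.mem_toFinset, Sigma.exists, build, r]
    constructor
    · rintro ⟨qs, ϱs, h1, h2, rfl⟩
      exact ⟨qs, ϱs, ⟨h1, h2⟩, rfl⟩
    · rintro ⟨qs, ϱs, ⟨h1, h2⟩, rfl⟩
      exact ⟨qs, ϱs, h1, h2, rfl⟩
  have hinj : Function.Injective build := by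
    rintro ⟨qs, ϱs⟩ ⟨qs', ϱs'⟩ e
    obtain ⟨e1, e2⟩ := HRule.graft_inj e
    obtain ⟨rfl, -⟩ := markRule_inj (hT.nonerasing σ) (hT.nondeleting σ) e1
    congr
    funext j
    obtain ⟨m, hm⟩ := exists_isLeastOcc (hT.nondeleting σ j)
    simpa [spread_of_isLeastOcc hm] using e2 m _ (markRule_lhs_sub _ _ _ _ hm.1)
  have hR : ∀ j q', M.stateWeight (h.apply (ss j)) (some q') = ∑ ϱ ∈ R j q', M.weight ϱ :=
    fun j q' => finsum_mem_eq_finite_toFinset_sum _ (finite_runs hT (ss j) q')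
  change M.stateWeight _ _ = ∑ qs, M.wt (r qs) * ∏ j, M.stateWeight _ _
  rw [WTAh.stateWeight, hI, finsum_mem_coe_finset, Finset.sum_image hinj.injOn, Finset.sum_sigma,
    Finset.sum_filter_of_ne (p := fun qs => r qs ∈ M.rules)]
  · refine Finset.sum_congr rfl fun qs _ => ?_
    simp only [hR, Finset.prod_univ_sum, Finset.mul_sum]
    exact Finset.sum_congr rfl fun ϱs _ =>
      weight_graft_spread _ (hT.nondeleting σ) _ _ _ _ _
  -- State tuples that yield no rule may be included in the sum, because the weight function
  -- vanishes on the corresponding `markRule`.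
  · intro qs _ h0
    obtain ⟨ϱs, -, h1⟩ := Finset.exists_ne_zero_of_sum_ne_zero h0
    refine mem_rules_of_wt_ne_zero (markRule_target _ _ _ _) fun hw => h1 ?_
    simp only [build, r] at hw ⊢
    rw [weight_graft_spread _ (hT.nondeleting σ), hw, zero_mul]

/-- The recursion for the weights in terms of the rules of the automaton `A`. -/
theorem stateWeight_node_eq_sum_rules (hT : h.TetrisFree) (σ : S)
    (ss : Fin (rkS σ) → RTree rkS Empty) (q : Q) (W : ℕ → Q → K)
    (hW : ∀ (j : Fin (rkS σ)) q', W j q' =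
      (imageWTAh A h hT.nonerasing).stateWeight (h.apply (ss j)) (some q'))
    [DecidablePred fun r : WTARule rkS Q => h.symbolImage r.sym = h.symbolImage σ ∧ r.target = q] :
    (imageWTAh A h hT.nonerasing).stateWeight (h.apply (.node σ ss)) (some q) =
      ∑ r ∈ A.rules with h.symbolImage r.sym = h.symbolImage σ ∧ r.target = q,
        A.wt r * ∏ j : Fin (rkS r.sym), W j (r.states j) := by
  classical
  have hw : ∀ qs, (imageWTAh A h hT.nonerasing).wt (markRule (h σ) (hT.nonerasing σ) qs q) =
      ∑ r ∈ A.rules with homRule h hT.nonerasing r = markRule (h σ) (hT.nonerasing σ) qs q,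
        A.wt r := fun qs => by
    rw [imageWTAh_wt_of_target (markRule_target _ _ _ _)]
  rw [stateWeight_node hT]
  simp only [← hW, hw, Finset.sum_mul, Finset.sum_filter, ite_mul, zero_mul]
  -- After the exchange, each rule of `A` with the right symbol image and target selects exactly one
  -- tuple, its own, and all other rules select none.
  rw [Finset.sum_comm]
  refine Finset.sum_congr rfl fun r _ => ?_
  split_ifs with hr
  · obtain ⟨hr, rfl⟩ := hr
    have key : ∀ (k : ℕ) (u : RTree rkD (Fin k)) (hu : ∀ i, u ≠ .var i)
        (_ : (⟨rkS σ, h σ⟩ : Σ k, RTree rkD (Fin k)) = ⟨k, u⟩) (qs' : Fin k → Q) (a : K),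
        (∑ qs : Fin (rkS σ) → Q, if markRule u hu qs' r.target =
            markRule (h σ) (hT.nonerasing σ) qs r.target then
          a * ∏ j : Fin (rkS σ), W j (qs j) else 0) = a * ∏ j : Fin k, W j (qs' j) := by
      rintro _ _ hu ⟨⟩ qs' a
      rw [Finset.sum_eq_single qs', if_pos rfl]
      · intro qs _ hqs
        exact if_neg fun e => hqs (markRule_inj hu (hT.nondeleting σ) e).1.symm
      · simp
    exact key _ _ _ (hT.nondeleting.sigma_eq hr.symm) r.states _
  · refine Finset.sum_eq_zero fun qs _ => if_neg fun e => hr ⟨?_, ?_⟩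
    · exact symbolImage_eq_of_homRule_eq hT (.node σ ss) e
    · have := congrArg HRule.target e
      simpa [homRule_target, markRule_target] using this

end Weights

/-! ### Input contexts and the holes of their images. -/

namespace RTree

variable {S : Type} {rk : S → ℕ} {Z : Type}

/-- A ground tree as a tree without occurrences of variables. -/
def ofGround (t : RTree rk Empty) : RTree rk Z := t.subst Empty.elim

theorem ofGround_subst {Z' : Type} (t : RTree rk Empty) (θ : Z → RTree rk Z') :
    (ofGround t : RTree rk Z).subst θ = ofGround t := by
  rw [ofGround, subst_subst, ofGround]
  congr 1
  funext e
  exact e.elim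

theorem ofGround_self (t : RTree rk Empty) : (ofGround t : RTree rk Empty) = t := by
  rw [ofGround]
  convert subst_var t using 2

theorem ofGround_sub_ne_var (t : RTree rk Empty) (p : List ℕ) (z : Z) :
    (ofGround t : RTree rk Z).sub p ≠ some (var z) := by
  intro h
  obtain ⟨_, e, _⟩ := sub_fill_eq_var t _ h
  exact e.elim

theorem eq_of_subst_eq_of_holes (u u' : RTree rk Unit) {t t' : RTree rk Empty}
    (h : (u.subst fun _ => t) = u'.subst fun _ => t')
    (hh : ∀ p, u.sub p = some (var ()) ↔ u'.sub p = some (var ())) : u = u' := by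
  induction u generalizing u' with
  | var z =>
    have := (hh []).1 (by simp)
    simpa using this.symm
  | node s ts ih =>
    cases u' with
    | var z =>
      have := (hh []).2 (by simp)
      simp at this
    | node s' ts' =>
      simp only [subst_node, node.injEq] at h
      obtain ⟨rfl, h⟩ := h
      congr 1
      funext i
      refine ih i _ (congrFun (eq_of_heq h) i) fun p => ?_
      simpa [sub] using hh (i :: p)

end RTree

/-- A node of a tree together with one of its children, which is to be replaced; `args child` is
irrelevant. -/
structure Frame {S : Type} (rk : S → ℕ) : Type where
  sym : S
  child : Fin (rk sym)
  args : Fin (rk sym) → RTree rk Empty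

namespace Frame

variable {S : Type} {rk : S → ℕ}

/-- The tree in which the child of the frame is `s`. -/
def fillIn (f : Frame rk) (s : RTree rk Empty) : RTree rk Empty :=
  .node f.sym (Function.update f.args f.child s)

/-- Put `s` into the hole of the context that is given by its frames, from the root downwards. -/
def plug (c : List (Frame rk)) (s : RTree rk Empty) : RTree rk Empty := c.foldr fillIn s

@[simp] theorem plug_nil (s : RTree rk Empty) : plug [] s = s := rfl

@[simp] theorem plug_cons (f : Frame rk) (c : List (Frame rk)) (s : RTree rk Empty) :
    plug (f :: c) s = f.fillIn (plug c s) := rfl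

theorem plug_append (c c' : List (Frame rk)) (s : RTree rk Empty) :
    plug (c ++ c') s = plug c (plug c' s) := by
  simp [plug]

theorem fillIn_self (σ : S) (j : Fin (rk σ)) (ss : Fin (rk σ) → RTree rk Empty) :
    (⟨σ, j, ss⟩ : Frame rk).fillIn (ss j) = .node σ ss := by
  simp [fillIn]

end Frame

namespace TreeHom

variable {S D : Type} {rkS : S → ℕ} {rkD : D → ℕ} (h : TreeHom rkS rkD)

open Frame

/-- The image of a context. -/
def ctxImage : List (Frame rkS) → RTree rkD Unit
  | [] => .var ()
  | f :: c => RTree.subst (h f.sym)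
      (Function.update (fun j => ofGround (h.apply (f.args j))) f.child (ctxImage c))

/-- `p` is the main position of the hole in the image of a context: the path along least
occurrences. -/
def IsMainPos : List (Frame rkS) → List ℕ → Prop
  | [], p => p = []
  | f :: c, p => ∃ m p', RTree.IsLeastOcc (h f.sym) f.child m ∧ IsMainPos c p' ∧ p = m ++ p'

/-- The positions `w` and `w'` are equal up to the choice of an occurrence of a variable in the
image of a symbol of `s`, where the path to this symbol runs along least occurrences. -/
def Linked (s : RTree rkS Empty) (w w' : List ℕ) : Prop :=
  ∃ c σ ss j p u u' v, s = plug c (.node σ ss) ∧ h.IsMainPos c p ∧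
    RTree.sub (h σ) u = some (.var j) ∧ RTree.sub (h σ) u' = some (.var j) ∧
    w = p ++ u ++ v ∧ w' = p ++ u' ++ v

variable {h}

theorem exists_isMainPos (hd : h.Nondeleting) (c : List (Frame rkS)) : ∃ p, h.IsMainPos c p := by
  induction c with
  | nil => exact ⟨[], rfl⟩
  | cons f c ih =>
    obtain ⟨p, hp⟩ := ih
    obtain ⟨m, hm⟩ := exists_isLeastOcc (hd f.sym f.child)
    exact ⟨m ++ p, m, p, hm, hp, rfl⟩

theorem apply_fillIn (f : Frame rkS) (s : RTree rkS Empty) :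
    h.apply (f.fillIn s) = RTree.subst (h f.sym)
      (Function.update (fun j => h.apply (f.args j)) f.child (h.apply s)) := by
  rw [fillIn, apply_node]
  congr 1
  funext j
  by_cases hj : j = f.child
  · subst hj; simp
  · simp [hj]

theorem ctxImage_subst (c : List (Frame rkS)) (s : RTree rkS Empty) :
    ((h.ctxImage c).subst fun _ => h.apply s) = h.apply (plug c s) := by
  induction c with
  | nil => rfl
  | cons f c ih =>
    rw [ctxImage, subst_subst, plug_cons, apply_fillIn, ← ih]
    congr 1
    funext j
    by_cases hj : j = f.child
    · subst hj; simp
    · simp [hj, ofGround_subst, ofGround_self]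

theorem ctxImage_cons_sub {f : Frame rkS} {c : List (Frame rkS)} {w : List ℕ} :
    (h.ctxImage (f :: c)).sub w = some (.var ()) ↔
      ∃ u w', RTree.sub (h f.sym) u = some (.var f.child) ∧
        (h.ctxImage c).sub w' = some (.var ()) ∧ w = u ++ w' := by
  constructor
  · intro hw
    obtain ⟨u, j, v, h1, rfl, h3⟩ := sub_fill_eq_var _ _ hw
    by_cases hj : j = f.child
    · subst hj
      exact ⟨u, v, h1, by simpa using h3, rfl⟩
    · simp only [Function.update_of_ne hj] at h3
      exact absurd h3 (ofGround_sub_ne_var _ _ _)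
  · rintro ⟨u, w', h1, h2, rfl⟩
    rw [ctxImage, sub_subst_append _ _ h1]
    simpa using h2

theorem IsMainPos.hole_append {c c' : List (Frame rkS)} {p w : List ℕ} (hp : h.IsMainPos c p)
    (hw : (h.ctxImage c').sub w = some (.var ())) :
    (h.ctxImage (c ++ c')).sub (p ++ w) = some (.var ()) := by
  induction c generalizing p with
  | nil =>
    obtain rfl : p = [] := hp
    exact hw
  | cons f c ih =>
    obtain ⟨m, p, hm, hp, rfl⟩ := hp
    exact ctxImage_cons_sub.2 ⟨m, p ++ w, hm.1, ih hp, by simp⟩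

theorem IsMainPos.hole {c : List (Frame rkS)} {p : List ℕ} (hp : h.IsMainPos c p) :
    (h.ctxImage c).sub p = some (.var ()) := by
  simpa using hp.hole_append (c' := []) (w := []) rfl

theorem IsMainPos.apply_sub {c : List (Frame rkS)} {p : List ℕ} (hp : h.IsMainPos c p)
    (s : RTree rkS Empty) (v : List ℕ) : (h.apply (plug c s)).sub (p ++ v) = (h.apply s).sub v := by
  rw [← ctxImage_subst, sub_subst_append _ _ hp.hole]

/-- Occurrences of variables are incomparable, so a link at the root symbol that starts in a hole
exchanges two occurrences of the child on the path, and a link further down must enter that same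
child, where induction applies. With an empty context the hole is the root, which no link can start
from, since no image is a variable. -/
theorem Linked.hole (hne : h.Nonerasing) {c : List (Frame rkS)} {s : RTree rkS Empty}
    {w w' : List ℕ} (hl : h.Linked (plug c s) w w')
    (hw : (h.ctxImage c).sub w = some (.var ())) : (h.ctxImage c).sub w' = some (.var ()) := by
  induction c generalizing w w' with
  | nil =>
    obtain ⟨c', σ, ss, j, p, u, u', v, -, -, hu, -, rfl, -⟩ := hl
    have hw' : p ++ u ++ v = [] := by
      by_contra hcon
      obtain ⟨a, l, e⟩ := List.exists_cons_of_ne_nil hcon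
      simp [e, ctxImage, sub] at hw
    simp only [List.append_eq_nil_iff] at hw'
    rw [hw'.1.2, sub_nil, Option.some.injEq] at hu
    exact absurd hu (hne σ j)
  | cons f c ih =>
    obtain ⟨c', σ, ss, j, p, u, u', v, e, hp, hu, hu', rfl, rfl⟩ := hl
    obtain ⟨u1, w1, h1, h2, e1⟩ := ctxImage_cons_sub.1 hw
    cases c' with
    | nil =>
      obtain rfl : p = [] := hp
      simp only [plug_cons, fillIn, plug_nil, node.injEq] at e
      obtain ⟨rfl, e⟩ := e
      simp only [List.nil_append] at e1 ⊢
      obtain ⟨rfl, rfl, rfl⟩ := prefix_unique _ hu h1 e1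
      exact ctxImage_cons_sub.2 ⟨u', v, hu', h2, rfl⟩
    | cons g c' =>
      obtain ⟨m, p, hm, hp, rfl⟩ := hp
      obtain ⟨f1, f2, f3⟩ := f
      obtain ⟨g1, g2, g3⟩ := g
      simp only [plug_cons, fillIn, node.injEq] at e h1 hm
      obtain ⟨rfl, e⟩ := e
      simp only [List.append_assoc] at e1
      obtain ⟨rfl, rfl, rfl⟩ := prefix_unique _ hm.1 h1 e1
      have e2 := congrFun (eq_of_heq e) g2
      simp only [Function.update_self] at e2
      refine ctxImage_cons_sub.2 ⟨m, p ++ u' ++ v, h1, ?_, by simp⟩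
      exact ih ⟨c', σ, ss, j, p, u, u', v, e2, hp, hu, hu', rfl, rfl⟩ (by simpa using h2)

theorem Linked.symm {s : RTree rkS Empty} {w w' : List ℕ} (hl : h.Linked s w w') :
    h.Linked s w' w := by
  obtain ⟨c, σ, ss, j, p, u, u', v, e, hp, hu, hu', rfl, rfl⟩ := hl
  exact ⟨c, σ, ss, j, p, u', u, v, e, hp, hu', hu, rfl, rfl⟩

/-- Occurrences are switched from the inside out: links below the root start on the main path, so
the lower part of `w` is reached below the least occurrence `m` first, and then `m` is exchanged for
the required occurrence. -/
theorem eqvGen_linked_of_hole {c : List (Frame rkS)} {p w : List ℕ} (s : RTree rkS Empty)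
    (hp : h.IsMainPos c p) (hw : (h.ctxImage c).sub w = some (.var ())) :
    Relation.EqvGen (h.Linked (plug c s)) p w := by
  induction c generalizing p w with
  | nil =>
    obtain rfl : p = [] := hp
    cases w with
    | nil => exact .refl _
    | cons i w => simp [ctxImage, sub] at hw
  | cons f c ih =>
    obtain ⟨m, p, hm, hp, rfl⟩ := hp
    obtain ⟨u, w, hu, hw', rfl⟩ := ctxImage_cons_sub.1 hw
    have lift : ∀ a b, Relation.EqvGen (h.Linked (plug c s)) a b →
        Relation.EqvGen (h.Linked (plug (f :: c) s)) (m ++ a) (m ++ b) := by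
      intro a b hab
      induction hab with
      | rel a b hab =>
        obtain ⟨c', σ, ss, j, p, u, u', v, e, hp, hu, hu', rfl, rfl⟩ := hab
        refine .rel _ _ ⟨f :: c', σ, ss, j, m ++ p, u, u', v, ?_, ⟨m, p, hm, hp, rfl⟩, hu, hu',
          by simp, by simp⟩
        rw [plug_cons, plug_cons, e]
      | refl a => exact .refl _
      | symm a b _ ih => exact ih.symm
      | trans a b c _ _ ih1 ih2 => exact ih1.trans _ _ _ ih2
    refine (lift _ _ (ih hp hw')).trans _ _ _ (.rel _ _ ?_)
    exact ⟨[], f.sym, _, f.child, [], m, u, w, rfl, rfl, hm.1, hu, rfl, rfl⟩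

theorem eqvGen_linked_iff_hole (hT : h.TetrisFree) {c : List (Frame rkS)} {w₀ w : List ℕ}
    (s : RTree rkS Empty) (hw₀ : (h.ctxImage c).sub w₀ = some (.var ())) :
    Relation.EqvGen (h.Linked (plug c s)) w₀ w ↔ (h.ctxImage c).sub w = some (.var ()) := by
  constructor
  · intro hw
    have : ∀ a b, Relation.EqvGen (h.Linked (plug c s)) a b →
        ((h.ctxImage c).sub a = some (.var ()) ↔ (h.ctxImage c).sub b = some (.var ())) := by
      intro a b hab
      induction hab with
      | rel a b hab => exact ⟨hab.hole hT.nonerasing, hab.symm.hole hT.nonerasing⟩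
      | refl a => rfl
      | symm a b _ ih => exact ih.symm
      | trans a b c _ _ ih1 ih2 => exact ih1.trans ih2
    exact (this _ _ hw).1 hw₀
  · intro hw
    obtain ⟨p, hp⟩ := exists_isMainPos hT.nondeleting c
    exact (eqvGen_linked_of_hole s hp hw₀).symm.trans _ _ _ (eqvGen_linked_of_hole s hp hw)

end TreeHom

open Frame

theorem WTAh.exists_isAcceptingRun {K : Type*} [CommSemiring K] {Q D : Type} {rkD : D → ℕ}
    (M : WTAh K Q rkD) {t : RTree rkD Empty} (ht : M.series t ≠ 0) :
    ∃ ϱ, M.IsAcceptingRun ϱ t := by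
  obtain ⟨q, hq, h1⟩ := Finset.exists_ne_zero_of_sum_ne_zero ht
  obtain ⟨ϱ, hϱ, h2⟩ := exists_ne_zero_of_finsum_mem_ne_zero h1
  exact ⟨ϱ, q, hq, hϱ, h2⟩

/-! ### Constrained classes are hole sets. -/

section Structure

variable {S D : Type} {rkS : S → ℕ} {rkD : D → ℕ} {Q : Type} [Finite D]
variable {K : Type*} [CommSemiring K] {A : WTA K Q rkS} {h : TreeHom rkS rkD}

/-- Proper states are placed at least occurrences, so along the main path the run never enters the
sink. The rule there may depend on the run, but its constraints are fixed by `h σ`. -/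
theorem isRun_label_of_isMainPos (hT : h.TetrisFree) {c : List (Frame rkS)} {p : List ℕ} {σ : S}
    {ss : Fin (rkS σ) → RTree rkS Empty} {q : Q} {ϱ : RunTree rkD (Option Q)}
    (hrun : (imageWTAh A h hT.nonerasing).IsRun ϱ (h.apply (plug c (.node σ ss))) (some q))
    (hp : h.IsMainPos c p) :
    ∃ r, ϱ.label p = some (.inl (.inr r)) ∧ ∀ u u', r.E u u' ↔
      ∃ j, RTree.sub (h σ) u = some (.var j) ∧ RTree.sub (h σ) u' = some (.var j) := by
  induction c generalizing p q ϱ with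
  | nil =>
    obtain rfl : p = [] := hp
    obtain ⟨qs, ϱs, -, -, e⟩ := (isRun_node_iff hT).1 hrun
    refine ⟨_, ?_, markRule_E (h σ) (hT.nonerasing σ) qs q⟩
    rw [e]
    simp [HRule.graft, label, rootLabel]
  | cons f c ih =>
    obtain ⟨m, p, hm, hp, rfl⟩ := hp
    obtain ⟨qs, ϱs, -, h2, e⟩ := (isRun_node_iff hT).1 hrun
    have := h2 f.child
    rw [Function.update_self] at this
    obtain ⟨r, hr, hE⟩ := ih this hp
    refine ⟨r, ?_, hE⟩
    rw [e, label, HRule.sub_graft_append _ _ (markRule_lhs_sub _ _ _ _ hm.1),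
      spread_of_isLeastOcc hm]
    exact hr

/-- Sink rules have only trivial constraints, so a nontrivial one must sit on a path through least
occurrences. -/
theorem isMainPos_of_isRun_label (hT : h.TetrisFree) {s : RTree rkS Empty} {p u u' : List ℕ}
    {q : Q} {ϱ : RunTree rkD (Option Q)} {r : HRule rkD (Option Q)}
    (hrun : (imageWTAh A h hT.nonerasing).IsRun ϱ (h.apply s) (some q))
    (hp : ϱ.label p = some (.inl (.inr r))) (hE : r.E u u') (hu : u ≠ u') :
    ∃ c σ ss j, s = plug c (.node σ ss) ∧ h.IsMainPos c p ∧
      RTree.sub (h σ) u = some (.var j) ∧ RTree.sub (h σ) u' = some (.var j) := by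
  induction s generalizing p q ϱ with
  | var e => exact e.elim
  | node σ ss ih =>
    obtain ⟨qs, ϱs, -, h2, rfl⟩ := (isRun_node_iff hT).1 hrun
    rcases HRule.graft_label _ _ hp with ⟨rfl, rfl⟩ | ⟨p, z, v, h3, rfl, h4⟩
    · obtain ⟨j, hj⟩ := (markRule_E _ _ _ _ _ _).1 hE
      exact ⟨[], σ, ss, j, rfl, rfl, hj⟩
    · obtain ⟨j, hj, -⟩ := (markRule_lhs_sub_iff _ _ _ _).1 h3
      by_cases hl : (h σ).IsLeastOcc j p
      · rw [spread_of_isLeastOcc hl] at h4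
        obtain ⟨c, σ', ss', j', e, hv, h5⟩ := ih j (h2 j) h4
        refine ⟨⟨σ, j, ss⟩ :: c, σ', ss', j', ?_, ⟨p, v, hl, hv, rfl⟩, h5⟩
        rw [plug_cons, ← e, fillIn_self]
      · rw [spread_of_not_isLeastOcc hj hl] at h4
        obtain ⟨d, rfl⟩ := sinkRun_label _ h4
        exact absurd hE.1 hu

/-- The right-hand side does not mention the run: the generated equivalence is a property of the
input tree alone. -/
theorem eqvGen_forcedEqual_iff (hT : h.TetrisFree) {s : RTree rkS Empty} {q : Q}
    {ϱ : RunTree rkD (Option Q)}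
    (hrun : (imageWTAh A h hT.nonerasing).IsRun ϱ (h.apply s) (some q)) {w w' : List ℕ} :
    Relation.EqvGen (WTAh.ForcedEqual ϱ) w w' ↔ Relation.EqvGen (h.Linked s) w w' := by
  constructor
  · intro hw
    induction hw with
    | rel a b hab =>
      obtain ⟨p, r, u, u', v, h1, h2, rfl, rfl⟩ := hab
      by_cases hu : u = u'
      · subst hu
        exact .refl _
      · obtain ⟨c, σ, ss, j, e, hp, h3, h4⟩ := isMainPos_of_isRun_label hT hrun h1 h2 hu
        exact .rel _ _ ⟨c, σ, ss, j, p, u, u', v, e, hp, h3, h4, rfl, rfl⟩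
    | refl a => exact .refl _
    | symm a b _ ih => exact ih.symm
    | trans a b c _ _ ih1 ih2 => exact ih1.trans _ _ _ ih2
  · refine Relation.EqvGen.mono (fun a b hab => ?_) w w'
    obtain ⟨c, σ, ss, j, p, u, u', v, rfl, hp, hu, hu', rfl, rfl⟩ := hab
    obtain ⟨r, h1, h2⟩ := isRun_label_of_isMainPos hT hrun hp
    exact ⟨p, r, u, u', v, h1, (h2 u u').2 ⟨j, hu, hu'⟩, rfl, rfl⟩

/-- The hole of the context is a child whose variable occurs twice. -/
def TreeHom.IsDuplicating (h : TreeHom rkS rkD) (c : List (Frame rkS)) : Prop :=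
  ∃ c' f u u', c = c' ++ [f] ∧ u ≠ u' ∧ RTree.sub (h f.sym) u = some (.var f.child) ∧
    RTree.sub (h f.sym) u' = some (.var f.child)

theorem exists_context_of_directlyConstrained (hT : h.TetrisFree) {t : RTree rkD Empty}
    {ϱ : RunTree rkD (Option Q)} (hϱ : (imageWTAh A h hT.nonerasing).IsAcceptingRun ϱ t)
    {p p' : List ℕ} (hc : WTAh.DirectlyConstrained ϱ p p') :
    ∃ c s, h.IsDuplicating c ∧ t = h.apply (plug c s) ∧
      (h.ctxImage c).sub (p ++ p') = some (.var ()) := by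
  obtain ⟨q, hq, hrun, -⟩ := hϱ
  obtain ⟨q, -, rfl⟩ := Finset.mem_map.1 hq
  obtain ⟨r, p'', h1, h2, h3⟩ := hc
  obtain ⟨s, rfl⟩ := exists_preimage_of_isRun hT.nondeleting hrun
  obtain ⟨c, σ, ss, j, rfl, hp, h4, h5⟩ := isMainPos_of_isRun_label hT hrun h1 h2 h3
  refine ⟨c ++ [⟨σ, j, ss⟩], ss j, ⟨c, ⟨σ, j, ss⟩, p', p'', rfl, h3, h4, h5⟩, ?_, ?_⟩
  · rw [plug_append, plug_cons, plug_nil, fillIn_self]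
  · exact hp.hole_append (TreeHom.ctxImage_cons_sub.2 ⟨p', [], h4, rfl, by simp⟩)

theorem TreeHom.IsDuplicating.exists_directlyConstrained (hT : h.TetrisFree)
    {c : List (Frame rkS)} (hc : h.IsDuplicating c) {s : RTree rkS Empty}
    {ϱ : RunTree rkD (Option Q)}
    (hϱ : (imageWTAh A h hT.nonerasing).IsAcceptingRun ϱ (h.apply (plug c s))) :
    ∃ p p', WTAh.DirectlyConstrained ϱ p p' ∧
      (h.ctxImage c).sub (p ++ p') = some (.var ()) := by
  obtain ⟨c, f, u, u', rfl, huu, hu, hu'⟩ := hc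
  obtain ⟨q, hq, hrun, -⟩ := hϱ
  obtain ⟨q, -, rfl⟩ := Finset.mem_map.1 hq
  obtain ⟨p, hp⟩ := TreeHom.exists_isMainPos hT.nondeleting c
  rw [plug_append] at hrun
  obtain ⟨r, h1, h2⟩ := isRun_label_of_isMainPos hT hrun hp
  exact ⟨p, u, ⟨r, u', h1, (h2 u u').2 ⟨f.child, hu, hu'⟩, huu⟩,
    hp.hole_append (TreeHom.ctxImage_cons_sub.2 ⟨u, [], hu, rfl, by simp⟩)⟩

theorem class_eq_holes (hT : h.TetrisFree) {c : List (Frame rkS)} {s : RTree rkS Empty}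
    {ϱ : RunTree rkD (Option Q)}
    (hϱ : (imageWTAh A h hT.nonerasing).IsAcceptingRun ϱ (h.apply (plug c s))) {w₀ : List ℕ}
    (hw₀ : (h.ctxImage c).sub w₀ = some (.var ())) :
    {w | Relation.EqvGen (WTAh.ForcedEqual ϱ) w₀ w} =
      {w | (h.ctxImage c).sub w = some (.var ())} := by
  obtain ⟨q, hq, hrun, -⟩ := hϱ
  obtain ⟨q, -, rfl⟩ := Finset.mem_map.1 hq
  ext w
  rw [Set.mem_ofPred_eq, eqvGen_forcedEqual_iff hT hrun, TreeHom.eqvGen_linked_iff_hole hT s hw₀]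
  rfl

theorem exists_context_of_isConstrainedClass (hT : h.TetrisFree) {t : RTree rkD Empty}
    {W : Set (List ℕ)} (hW : (imageWTAh A h hT.nonerasing).IsConstrainedClass t W) :
    ∃ c s, h.IsDuplicating c ∧ t = h.apply (plug c s) ∧
      W = {w | (h.ctxImage c).sub w = some (.var ())} := by
  obtain ⟨ϱ, p, p', hϱ, hc, rfl⟩ := hW
  obtain ⟨c, s, h1, rfl, h2⟩ := exists_context_of_directlyConstrained hT hϱ hc
  exact ⟨c, s, h1, rfl, class_eq_holes hT hϱ h2⟩

/-- Since the class is the same for all runs, any accepting run will do, and membership in the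
support provides one. -/
theorem TreeHom.IsDuplicating.isConstrainedClass (hT : h.TetrisFree) {c : List (Frame rkS)}
    (hc : h.IsDuplicating c) {s : RTree rkS Empty}
    (hs : (imageWTAh A h hT.nonerasing).series (h.apply (plug c s)) ≠ 0) :
    (imageWTAh A h hT.nonerasing).IsConstrainedClass (h.apply (plug c s))
      {w | (h.ctxImage c).sub w = some (.var ())} := by
  obtain ⟨ϱ, hϱ⟩ := WTAh.exists_isAcceptingRun _ hs
  obtain ⟨p, p', h1, h2⟩ := hc.exists_directlyConstrained hT hϱ
  exact ⟨ϱ, p, p', hϱ, h1, (class_eq_holes hT hϱ h2).symm⟩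

/-- The placeholders of a multi-context that form a class of constrained positions form the hole
of the image of a context. -/
theorem exists_context_of_multicontext (hT : h.TetrisFree) {C : RTree rkD Unit}
    {t₀ : RTree rkD Empty}
    (hC : (imageWTAh A h hT.nonerasing).IsConstrainedClass (C.subst fun _ => t₀)
      {p | C.sub p = some (.var ())}) :
    ∃ c s, h.IsDuplicating c ∧ C = h.ctxImage c ∧ t₀ = h.apply s := by
  obtain ⟨c, s, h1, h2, h3⟩ := exists_context_of_isConstrainedClass hT hC
  have hh : ∀ p, C.sub p = some (.var ()) ↔ (h.ctxImage c).sub p = some (.var ()) :=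
    fun p => Set.ext_iff.1 h3 p
  obtain ⟨p, hp⟩ := TreeHom.exists_isMainPos hT.nondeleting c
  have ht : t₀ = h.apply s := by
    have := congrArg (fun t => t.sub (p ++ [])) h2
    simp only [hp.apply_sub, sub_subst_append C _ ((hh p).2 hp.hole), sub_nil] at this
    simpa using this
  refine ⟨c, s, h1, eq_of_subst_eq_of_holes _ _ (t := t₀) (t' := t₀) ?_ hh, ht⟩
  rw [h2, ht, TreeHom.ctxImage_subst]

/-- The large duplication property in terms of the input trees. -/
theorem hasLDP_iff (hT : h.TetrisFree) {N : ℕ} :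
    (imageWTAh A h hT.nonerasing).HasLDP N ↔
      ∃ c s, h.IsDuplicating c ∧
        (imageWTAh A h hT.nonerasing).series (h.apply (plug c s)) ≠ 0 ∧
        N ≤ (h.apply s).height := by
  constructor
  · rintro ⟨t, ϱ, p, p', t', h1, h2, h3, h4, h5⟩
    obtain ⟨c, s, h6, rfl, h7⟩ := exists_context_of_directlyConstrained hT h2 h3
    refine ⟨c, s, h6, h1, ?_⟩
    have := sub_subst_append (h.ctxImage c) (fun _ => h.apply s) h7 []
    rw [TreeHom.ctxImage_subst, List.append_nil, h4, sub_nil, Option.some.injEq] at this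
    rwa [← this]
  · rintro ⟨c, s, h1, h2, h3⟩
    obtain ⟨ϱ, hϱ⟩ := WTAh.exists_isAcceptingRun _ h2
    obtain ⟨p, p', h4, h5⟩ := h1.exists_directlyConstrained hT hϱ
    refine ⟨_, ϱ, p, p', _, h2, hϱ, h4, ?_, h3⟩
    have := sub_subst_append (h.ctxImage c) (fun _ => h.apply s) h5 []
    rwa [TreeHom.ctxImage_subst, List.append_nil, sub_nil] at this

end Structure

/-! ### Height and size under substitution and in contexts. -/

namespace RTree

variable {S : Type} {rk : S → ℕ} {Z Z' : Type}

theorem height_child_lt (s : S) (ts : Fin (rk s) → RTree rk Z) (i : Fin (rk s)) :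
    (ts i).height < (node s ts).height :=
  Finset.le_sup (f := fun i => (ts i).height + 1) (Finset.mem_univ i)

theorem length_add_height_le {t t' : RTree rk Z} {p : List ℕ} (h : t.sub p = some t') :
    p.length + t'.height ≤ t.height := by
  induction p generalizing t with
  | nil =>
    rw [sub_nil, Option.some.injEq] at h
    simp [h]
  | cons i p ih =>
    cases t with
    | var z => simp [sub] at h
    | node s ts =>
      simp only [sub] at h
      split_ifs at h with hi
      have := ih h
      have := height_child_lt s ts ⟨i, hi⟩
      rw [List.length_cons]
      omega

theorem height_subst_le (u : RTree rk Z) (θ : Z → RTree rk Z') {B : ℕ}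
    (hB : ∀ z, (θ z).height ≤ B) : (u.subst θ).height ≤ u.height + B := by
  induction u with
  | var z => simpa [height, subst, fill] using hB z
  | node s ts ih =>
    rw [subst_node]
    refine Finset.sup_le fun i _ => ?_
    have := ih i
    have := height_child_lt s ts i
    change ((ts i).subst θ).height + 1 ≤ _
    omega

/-- Truncation at `N` is compatible with maxima and with successors, so truncated heights can be
computed from truncated heights. -/
theorem min_height_subst_congr (u : RTree rk Z) {θ θ' : Z → RTree rk Z'} {N : ℕ}
    (hN : ∀ z, min (θ z).height N = min (θ' z).height N) :
    min (u.subst θ).height N = min (u.subst θ').height N := by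
  induction u with
  | var z => exact hN z
  | node s ts ih =>
    simp only [subst_node, height]
    have := fun f : Fin (rk s) → ℕ => Finset.sup_inf_distrib_right Finset.univ f N
    rw [this, this]
    refine Finset.sup_congr rfl fun i _ => ?_
    have := ih i
    omega

/-- The number of nodes of a tree. -/
def size : RTree rk Z → ℕ
  | var _ => 1
  | node _ ts => 1 + ∑ i, size (ts i)

theorem size_child_lt (s : S) (ts : Fin (rk s) → RTree rk Z) (i : Fin (rk s)) :
    (ts i).size < (node s ts).size := by
  have := Finset.single_le_sum (f := fun i => (ts i).size) (fun _ _ => Nat.zero_le _)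
    (Finset.mem_univ i)
  simp only [size]
  omega

end RTree

namespace Frame

variable {S : Type} {rk : S → ℕ}

theorem height_lt_fillIn (f : Frame rk) (s : RTree rk Empty) : s.height < (f.fillIn s).height := by
  have := height_child_lt f.sym (Function.update f.args f.child s) f.child
  rwa [Function.update_self] at this

theorem length_add_height_le_plug (c : List (Frame rk)) (s : RTree rk Empty) :
    c.length + s.height ≤ (plug c s).height := by
  induction c with
  | nil => simp
  | cons f c ih =>
    have := f.height_lt_fillIn (plug c s)
    rw [plug_cons, List.length_cons]
    omega

theorem size_fillIn_lt (f : Frame rk) {s s' : RTree rk Empty} (hs : s.size < s'.size) :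
    (f.fillIn s).size < (f.fillIn s').size := by
  simp only [fillIn, size]
  refine Nat.add_lt_add_left (Finset.sum_lt_sum (fun i _ => ?_) ⟨f.child, Finset.mem_univ _, ?_⟩) _
  · by_cases hi : i = f.child
    · subst hi
      simpa using hs.le
    · simp [hi]
  · simpa using hs

theorem size_plug_lt (c : List (Frame rk)) {s s' : RTree rk Empty} (hs : s.size < s'.size) :
    (plug c s).size < (plug c s').size := by
  induction c with
  | nil => exact hs
  | cons f c ih => exact f.size_fillIn_lt ih

theorem size_le_plug (c : List (Frame rk)) (s : RTree rk Empty) : s.size ≤ (plug c s).size := by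
  induction c with
  | nil => rfl
  | cons f c ih =>
    have := size_child_lt f.sym (Function.update f.args f.child (plug c s)) f.child
    rw [Function.update_self] at this
    exact ih.trans this.le

theorem size_lt_plug {c : List (Frame rk)} (hc : c ≠ []) (s : RTree rk Empty) :
    s.size < (plug c s).size := by
  cases c with
  | nil => exact absurd rfl hc
  | cons f c =>
    have := size_child_lt f.sym (Function.update f.args f.child (plug c s)) f.child
    rw [Function.update_self] at this
    exact (size_le_plug c s).trans_lt this

/-- A longest path of a tree. -/
theorem exists_plug_eq_of_height (s : RTree rk Empty) :
    ∃ (c : List (Frame rk)) (s₀ : RTree rk Empty), s = plug c s₀ ∧ c.length = s.height := by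
  induction s with
  | var e => exact e.elim
  | node σ ss ih =>
    by_cases hσ : Nonempty (Fin (rk σ))
    · obtain ⟨i, -, hi⟩ := Finset.exists_mem_eq_sup Finset.univ Finset.univ_nonempty
        fun i => (ss i).height + 1
      obtain ⟨c, s₀, h1, h2⟩ := ih i
      refine ⟨⟨σ, i, ss⟩ :: c, s₀, ?_, ?_⟩
      · rw [plug_cons, ← h1, fillIn_self]
      · rw [List.length_cons, h2, height, hi]
    · refine ⟨[], .node σ ss, rfl, ?_⟩
      have : IsEmpty (Fin (rk σ)) := not_nonempty_iff.1 hσ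
      simp [height]

end Frame

/-! ### The pumping constant. -/

section Pumping

variable {S D : Type} {rkS : S → ℕ} {rkD : D → ℕ}

theorem TreeHom.Nonerasing.ne_nil {h : TreeHom rkS rkD} (hne : h.Nonerasing) {σ : S} {p : List ℕ}
    {j : Fin (rkS σ)} (hp : RTree.sub (h σ) p = some (.var j)) : p ≠ [] := by
  rintro rfl
  rw [sub_nil, Option.some.injEq] at hp
  exact hne σ j hp

/-- Every child survives strictly below the root of the image. Hence a finite set of images comes
from input trees of bounded height. -/
theorem TreeHom.TetrisFree.height_le_apply {h : TreeHom rkS rkD} (hT : h.TetrisFree)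
    (s : RTree rkS Empty) : s.height ≤ (h.apply s).height := by
  induction s with
  | var e => exact e.elim
  | node σ ss ih =>
    refine Finset.sup_le fun i _ => ?_
    obtain ⟨p, hp⟩ := hT.nondeleting σ i
    have h1 := sub_subst_append (h σ) (fun i => h.apply (ss i)) hp []
    rw [List.append_nil, sub_nil, ← TreeHom.apply_node] at h1
    have h2 := length_add_height_le h1
    have h3 := List.length_pos_iff.2 (hT.nonerasing.ne_nil hp)
    have := ih i
    omega

theorem TreeHom.height_apply_le (h : TreeHom rkS rkD) {M : ℕ} (hM : ∀ σ, (h σ).height ≤ M)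
    (s : RTree rkS Empty) : (h.apply s).height ≤ M * (s.height + 1) := by
  induction s with
  | var e => exact e.elim
  | node σ ss ih =>
    rw [TreeHom.apply_node]
    refine (height_subst_le (h σ) _ (B := M * (RTree.node σ ss).height) fun i => ?_).trans ?_
    · exact (ih i).trans (Nat.mul_le_mul_left M (height_child_lt σ ss i))
    · have := hM σ
      rw [mul_add, mul_one]
      omega

variable {Q : Type} [Finite D] [Fintype Q] {K : Type*} [Field K] {A : WTA K Q rkS}
  {h : TreeHom rkS rkD}

/-- The vector of the weights of all runs for the image of `s` to the states of `A`. -/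
noncomputable def imageVec (A : WTA K Q rkS) (hT : h.TetrisFree) (s : RTree rkS Empty) : Q → K :=
  fun q => (imageWTAh A h hT.nonerasing).stateWeight (h.apply s) (some q)

/-- The multilinear recursion, with all children but one fixed. -/
theorem exists_linear_fillIn (hT : h.TetrisFree) (f : Frame rkS) :
    ∃ L : (Q → K) →ₗ[K] Q → K, ∀ s, imageVec A hT (f.fillIn s) = L (imageVec A hT s) := by
  classical
  obtain ⟨σ, i, ss⟩ := f
  refine ⟨{
    toFun := fun v q => ∑ qs : Fin (rkS σ) → Q,
      (imageWTAh A h hT.nonerasing).wt (markRule (h σ) (hT.nonerasing σ) qs q) *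
        (v (qs i) * ∏ j ∈ Finset.univ.erase i, imageVec A hT (ss j) (qs j))
    map_add' := fun v w => by
      funext q
      simp only [Pi.add_apply, add_mul, mul_add, Finset.sum_add_distrib]
    map_smul' := fun a v => by
      funext q
      simp only [Pi.smul_apply, smul_eq_mul, Finset.mul_sum, RingHom.id_apply]
      exact Finset.sum_congr rfl fun qs _ => by ring }, fun s => ?_⟩
  funext q
  simp only [imageVec, fillIn, stateWeight_node hT, LinearMap.coe_mk, AddHom.coe_mk]
  refine Finset.sum_congr rfl fun qs _ => ?_
  rw [← Finset.mul_prod_erase _ _ (Finset.mem_univ i), Function.update_self]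
  congr 2
  refine Finset.prod_congr rfl fun j hj => ?_
  rw [Function.update_of_ne (Finset.ne_of_mem_erase hj)]

theorem exists_linear_plug (hT : h.TetrisFree) (c : List (Frame rkS)) :
    ∃ L : (Q → K) →ₗ[K] K,
      ∀ s, (imageWTAh A h hT.nonerasing).series (h.apply (plug c s)) = L (imageVec A hT s) := by
  have key : ∃ L : (Q → K) →ₗ[K] Q → K, ∀ s, imageVec A hT (plug c s) = L (imageVec A hT s) := by
    induction c with
    | nil => exact ⟨LinearMap.id, fun s => rfl⟩
    | cons f c ih =>
      obtain ⟨L, hL⟩ := ih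
      obtain ⟨L', hL'⟩ := exists_linear_fillIn (A := A) hT f
      exact ⟨L' ∘ₗ L, fun s => by rw [plug_cons, hL', hL, LinearMap.comp_apply]⟩
  obtain ⟨L, hL⟩ := key
  refine ⟨(∑ q ∈ A.final, LinearMap.proj q) ∘ₗ L, fun s => ?_⟩
  rw [series_eq_sum, LinearMap.comp_apply, ← hL]
  simp [imageVec]

/-- A tree of maximal height in the support of a context has height less than the number of
states. -/
theorem height_lt_card_of_maximal (hT : h.TetrisFree) (c : List (Frame rkS)) {s : RTree rkS Empty}
    (hs : (imageWTAh A h hT.nonerasing).series (h.apply (plug c s)) ≠ 0)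
    (hmax : ∀ s', (imageWTAh A h hT.nonerasing).series (h.apply (plug c s')) ≠ 0 →
      s'.height ≤ s.height) : s.height < Fintype.card Q := by
  obtain ⟨d, s₀, hd, hlen⟩ := exists_plug_eq_of_height s
  -- The vectors of the subtrees at all depths of a longest path. If they were independent, their
  -- number, the height plus one, would be at most the dimension.
  let x : Fin (s.height + 1) → Q → K := fun i => imageVec A hT (plug (d.drop i) s₀)
  suffices hli : LinearIndependent K x by
    simpa using hli.fintype_card_le_finrank
  by_contra hli
  obtain ⟨a, ha, hne⟩ := Fintype.not_linearIndependent_iff.1 hli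
  -- The last nonzero coefficient belongs to the smallest subtree in the relation, so every exchange
  -- with another member inserts a larger subtree.
  obtain ⟨i₀, hi₀, hlast⟩ := Set.exists_max_image {i | a i ≠ 0} id (Set.toFinite _) hne
  obtain ⟨L, hL⟩ := exists_linear_plug (A := A) hT (c ++ d.take i₀)
  have h0 := congrArg L ha
  rw [map_sum, map_zero, Finset.sum_eq_single i₀] at h0
  · simp only [map_smul, x, ← hL, smul_eq_mul] at h0
    rw [plug_append, ← plug_append (d.take i₀), List.take_append_drop, ← hd] at h0
    exact mul_ne_zero hi₀ hs h0
  · intro i _ hi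
    simp only [map_smul, x, ← hL, smul_eq_mul]
    by_cases hai : a i = 0
    · rw [hai, zero_mul]
    -- With the subtree of depth `i` at depth `i₀`, the height grows by at least `i₀ - i`; by
    -- maximality this tree has weight zero in the context, so only the term of `i₀` remains.
    · have hlt : i < i₀ := lt_of_le_of_ne (hlast i hai) hi
      rw [plug_append]
      by_contra hcon
      have h1 := hmax _ (right_ne_zero_of_mul hcon)
      have h2 := length_add_height_le_plug (d.take i₀) (plug (d.drop i) s₀)
      have h3 := length_add_height_le_plug (d.drop i) s₀
      rw [List.length_take] at h2
      rw [List.length_drop] at h3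
      have h4 := i.2
      have h5 := i₀.2
      have h6 : i.val < i₀.val := hlt
      omega
  · simp

/-- If only finitely many trees fit, a fitting input tree of maximal height exists and is lower than
the number of states, so `s₀` is too, and its image has height at most `M * Fintype.card Q`. -/
theorem isPumpingConstant_of_lt (hT : h.TetrisFree) {M N : ℕ} (hM : ∀ σ, (h σ).height ≤ M)
    (hN : M * Fintype.card Q < N) : (imageWTAh A h hT.nonerasing).IsPumpingConstant N := by
  intro C t₀ h1 h2 h3
  obtain ⟨c, s₀, hc, rfl, rfl⟩ := exists_context_of_multicontext hT h3
  by_contra hfin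
  rw [Set.not_infinite] at hfin
  obtain ⟨B, hB⟩ := (hfin.image RTree.height).bddAbove
  let X : Set ℕ := {n | ∃ s, (imageWTAh A h hT.nonerasing).series (h.apply (plug c s)) ≠ 0 ∧
    s.height = n}
  have hXB : BddAbove X := by
    refine ⟨B, ?_⟩
    rintro _ ⟨s, hs, rfl⟩
    refine (hT.height_le_apply s).trans (hB ⟨h.apply s, ⟨?_, ?_⟩, rfl⟩)
    · rwa [TreeHom.ctxImage_subst]
    · rw [TreeHom.ctxImage_subst]
      exact hc.isConstrainedClass hT hs
  rw [TreeHom.ctxImage_subst] at h1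
  have hX₀ : s₀.height ∈ X := ⟨s₀, h1, rfl⟩
  obtain ⟨s, hs, hmax⟩ := Nat.sSup_mem ⟨_, hX₀⟩ hXB
  have h4 := height_lt_card_of_maximal hT c hs fun s' hs' => by
    rw [hmax]
    exact le_csSup hXB ⟨s', hs', rfl⟩
  have h5 : s₀.height ≤ s.height := by
    rw [hmax]
    exact le_csSup hXB hX₀
  have h6 := h.height_apply_le hM s₀
  have h7 : M * (s₀.height + 1) ≤ M * Fintype.card Q := Nat.mul_le_mul_left M (by omega)
  omega

end Pumping

/-! ### A height bound for minimal witnesses. -/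

section Bound

variable {S D : Type} {rkS : S → ℕ} {rkD : D → ℕ}

/-- The variable `j` occurs at least twice in the image of `σ`. -/
def TreeHom.Duplicates (h : TreeHom rkS rkD) (σ : S) (j : Fin (rkS σ)) : Prop :=
  ∃ u u', u ≠ u' ∧ RTree.sub (h σ) u = some (.var j) ∧ RTree.sub (h σ) u' = some (.var j)

/-- Some subtree of `s` whose image has height at least `N` is duplicated. -/
def TreeHom.LargeDup (h : TreeHom rkS rkD) (N : ℕ) (s : RTree rkS Empty) : Prop :=
  ∃ c s', s = plug c s' ∧ h.IsDuplicating c ∧ N ≤ (h.apply s').height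

variable {h : TreeHom rkS rkD} {N : ℕ}

theorem TreeHom.largeDup_node {σ : S} {ss : Fin (rkS σ) → RTree rkS Empty} :
    h.LargeDup N (.node σ ss) ↔ (∃ i, h.LargeDup N (ss i)) ∨
      ∃ i, h.Duplicates σ i ∧ N ≤ (h.apply (ss i)).height := by
  constructor
  · rintro ⟨_, s', e, ⟨c, f, u, u', rfl, hu⟩, hN⟩
    cases c with
    | nil =>
      obtain ⟨f1, f2, f3⟩ := f
      simp only [List.nil_append, plug_cons, plug_nil, fillIn, node.injEq] at e hu
      obtain ⟨rfl, e⟩ := e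
      refine .inr ⟨f2, ⟨u, u', hu⟩, ?_⟩
      rwa [eq_of_heq e, Function.update_self]
    | cons g c =>
      obtain ⟨g1, g2, g3⟩ := g
      simp only [List.cons_append, plug_cons, fillIn, node.injEq] at e
      obtain ⟨rfl, e⟩ := e
      refine .inl ⟨g2, c ++ [f], s', ?_, ⟨c, f, u, u', rfl, hu⟩, hN⟩
      rw [eq_of_heq e, Function.update_self]
  · rintro (⟨i, c, s', e, ⟨c, f, u, u', rfl, hu⟩, hN⟩ | ⟨i, ⟨u, u', hu⟩, hN⟩)
    · refine ⟨⟨σ, i, ss⟩ :: (c ++ [f]), s', ?_, ⟨⟨σ, i, ss⟩ :: c, f, u, u', rfl, hu⟩, hN⟩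
      rw [plug_cons, ← e, fillIn_self]
    · refine ⟨[⟨σ, i, ss⟩], ss i, ?_, ⟨[], ⟨σ, i, ss⟩, u, u', rfl, hu⟩, hN⟩
      rw [plug_cons, plug_nil, fillIn_self]

/-- Truncated height and flag of a node are determined by those of its children, since the flag only
asks whether heights reach `N`. So the pair is a congruence of finite index. -/
theorem TreeHom.largeDup_plug_congr {s s' : RTree rkS Empty}
    (h1 : min (h.apply s).height N = min (h.apply s').height N)
    (h2 : h.LargeDup N s ↔ h.LargeDup N s') (c : List (Frame rkS)) :
    min (h.apply (plug c s)).height N = min (h.apply (plug c s')).height N ∧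
      (h.LargeDup N (plug c s) ↔ h.LargeDup N (plug c s')) := by
  induction c with
  | nil => exact ⟨h1, h2⟩
  | cons f c ih =>
    obtain ⟨ih1, ih2⟩ := ih
    have key : ∀ j, min (h.apply (Function.update f.args f.child (plug c s) j)).height N =
        min (h.apply (Function.update f.args f.child (plug c s') j)).height N ∧
        (h.LargeDup N (Function.update f.args f.child (plug c s) j) ↔
          h.LargeDup N (Function.update f.args f.child (plug c s') j)) := fun j => by
      by_cases hj : j = f.child
      · subst hj
        simpa using ⟨ih1, ih2⟩
      · simp [hj]
    have hle : ∀ j, N ≤ (h.apply (Function.update f.args f.child (plug c s) j)).height ↔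
        N ≤ (h.apply (Function.update f.args f.child (plug c s') j)).height := fun j => by
      have := (key j).1
      omega
    constructor
    · simp only [plug_cons, fillIn, TreeHom.apply_node]
      exact min_height_subst_congr _ fun j => (key j).1
    · simp only [plug_cons, fillIn, TreeHom.largeDup_node, (key _).2, hle]

variable {Q : Type} [Finite D] [Fintype Q] {K : Type*} [Field K] {A : WTA K Q rkS}

/-- Linear dependence alone would preserve the support but might lose the large duplication; the
tags ensure that the replacing subtree preserves both. -/
theorem height_lt_of_minimal (hT : h.TetrisFree) {s : RTree rkS Empty}
    (hs : (imageWTAh A h hT.nonerasing).series (h.apply s) ≠ 0) (hN : h.LargeDup N s)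
    (hmin : ∀ s', (imageWTAh A h hT.nonerasing).series (h.apply s') ≠ 0 → h.LargeDup N s' →
      s.size ≤ s'.size) : s.height < Fintype.card Q * ((N + 1) * 2) := by
  classical
  obtain ⟨d, s₀, hd, hlen⟩ := exists_plug_eq_of_height s
  let t : Fin (s.height + 1) → RTree rkS Empty := fun i => plug (d.drop i) s₀
  let κ : RTree rkS Empty → Fin (N + 1) × Bool := fun s =>
    (⟨min (h.apply s).height N, by omega⟩, decide (h.LargeDup N s))
  -- Each weight vector is put into the block of its tag, with zeros elsewhere. A relation among
  -- these vectors splits into one relation per tag, and the dimension is the asserted bound.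
  let x : Fin (s.height + 1) → Q × (Fin (N + 1) × Bool) → K := fun i y =>
    if κ (t i) = y.2 then imageVec A hT (t i) y.1 else 0
  suffices hli : LinearIndependent K x by
    have := hli.fintype_card_le_finrank
    simp at this
    omega
  by_contra hli
  obtain ⟨a, ha, hne⟩ := Fintype.not_linearIndependent_iff.1 hli
  -- The first nonzero coefficient belongs to the largest subtree in the relation: contrary to the
  -- pumping argument, a smaller tree is wanted.
  obtain ⟨i₀, hi₀, hfirst⟩ := Set.exists_min_image {i | a i ≠ 0} id (Set.toFinite _) hne
  obtain ⟨L, hL⟩ := exists_linear_plug (A := A) hT (d.take i₀)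
  -- The block of the tag of `t i₀`.
  have hv : ∑ i, (if κ (t i) = κ (t i₀) then a i else 0) • imageVec A hT (t i) = 0 := by
    funext q
    have := congrFun ha (q, κ (t i₀))
    simp only [Finset.sum_apply, Pi.smul_apply, smul_eq_mul, x, mul_ite, mul_zero,
      Pi.zero_apply, ite_mul, zero_mul] at this ⊢
    exact this
  have h0 := congrArg L hv
  rw [map_sum, map_zero, ← Finset.add_sum_erase _ _ (Finset.mem_univ i₀)] at h0
  have hne0 : L ((if κ (t i₀) = κ (t i₀) then a i₀ else 0) • imageVec A hT (t i₀)) ≠ 0 := by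
    rw [if_pos rfl, map_smul, ← hL, smul_eq_mul, ← plug_append, List.take_append_drop, ← hd]
    exact mul_ne_zero hi₀ hs
  have hne1 : ∑ i ∈ Finset.univ.erase i₀,
      L ((if κ (t i) = κ (t i₀) then a i else 0) • imageVec A hT (t i)) ≠ 0 :=
    fun h1 => hne0 (by rwa [h1, add_zero] at h0)
  obtain ⟨i, hi, h1⟩ := Finset.exists_ne_zero_of_sum_ne_zero hne1
  rw [map_smul, ← hL, smul_eq_mul] at h1
  have h2 := left_ne_zero_of_mul h1
  have h3 := right_ne_zero_of_mul h1
  rw [ne_eq, ite_eq_right_iff, Classical.not_imp] at h2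
  obtain ⟨h4, h5⟩ := h2
  simp only [κ, Prod.mk.injEq, Fin.mk.injEq, decide_eq_decide] at h4
  have hlt : i₀.val < i.val := lt_of_le_of_ne (hfirst i h5) fun e =>
    Finset.ne_of_mem_erase hi (Fin.ext e.symm)
  have h6 : s = plug (d.take i₀) (t i₀) := by
    rw [← plug_append, List.take_append_drop, hd]
  have h7 := hmin _ h3 ((TreeHom.largeDup_plug_congr h4.1 h4.2 _).2.2 (h6 ▸ hN))
  refine h7.not_gt ?_
  conv_rhs => rw [h6]
  refine size_plug_lt _ ?_
  have h8 : d.drop i₀ = (d.drop i₀).take (i - i₀) ++ d.drop i := by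
    conv_lhs => rw [← List.take_append_drop (i - i₀) (d.drop i₀), List.drop_drop]
    congr 2
    omega
  change (plug (d.drop i) s₀).size < (plug (d.drop i₀) s₀).size
  rw [h8, plug_append]
  refine size_lt_plug (fun e => ?_) _
  have := congrArg List.length e
  have h9 := i.2
  simp only [List.length_take, List.length_drop, List.length_nil] at this
  omega

theorem hasLDP_iff_exists_bounded (hT : h.TetrisFree) :
    (imageWTAh A h hT.nonerasing).HasLDP N ↔
      ∃ s, (imageWTAh A h hT.nonerasing).series (h.apply s) ≠ 0 ∧ h.LargeDup N s ∧
        s.height < Fintype.card Q * ((N + 1) * 2) := by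
  rw [hasLDP_iff hT]
  constructor
  · rintro ⟨c, s, h1, h2, h3⟩
    have hex : {s | (imageWTAh A h hT.nonerasing).series (h.apply s) ≠ 0 ∧
        h.LargeDup N s}.Nonempty := ⟨_, h2, c, s, rfl, h1, h3⟩
    obtain ⟨s', ⟨h4, h5⟩, h6⟩ := exists_minimalFor_of_wellFoundedLT _ RTree.size hex
    refine ⟨s', h4, h5, height_lt_of_minimal hT h4 h5 fun s'' h7 h8 => ?_⟩
    by_contra! hcon
    exact hcon.not_ge (h6 ⟨h7, h8⟩ hcon.le)
  · rintro ⟨_, h1, ⟨c, s, rfl, h2, h3⟩, -⟩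
    exact ⟨c, s, h2, h1, h3⟩

end Bound

/-! ### List operations with computable steps. -/

namespace Computable

variable {α β σ : Type*} [Primcodable α] [Primcodable β] [Primcodable σ]

theorem list_foldl {f : α → List β} {g : α → σ} {h : α → σ × β → σ} (hf : Computable f)
    (hg : Computable g) (hh : Computable₂ h) :
    Computable fun a => (f a).foldl (fun s b => h a (s, b)) (g a) := by
  -- The fold is a recursion on the index of the list entry; the default of `getD` is never used for
  -- indices below the length.
  have hstep : Computable₂ fun (a : α) (x : ℕ × σ) =>
      (Option.map (fun b => h a (x.2, b)) (f a)[x.1]?).getD x.2 :=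
    option_getD
      (option_map (list_getElem?.comp (hf.comp fst) (fst.comp snd))
        (hh.comp (fst.comp fst) ((snd.comp (snd.comp fst)).pair snd)).to₂)
      (snd.comp snd)
  refine (nat_rec (list_length.comp hf) hg hstep).of_eq fun a => ?_
  have key : ∀ n, (Nat.rec (g a)
      (fun n s => (Option.map (fun b => h a (s, b)) (f a)[n]?).getD s) n : σ) =
      ((f a).take n).foldl (fun s b => h a (s, b)) (g a) := by
    intro n
    induction n with
    | zero => rfl
    | succ n ih =>
      simp only [ih, List.take_add_one, List.foldl_append]
      cases (f a)[n]? <;> rfl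
  simpa using key (f a).length

theorem list_foldr {f : α → List β} {g : α → σ} {h : α → β × σ → σ} (hf : Computable f)
    (hg : Computable g) (hh : Computable₂ h) :
    Computable fun a => (f a).foldr (fun b s => h a (b, s)) (g a) :=
  (list_foldl (h := fun a x => h a (x.2, x.1)) (list_reverse.comp hf) hg
    (hh.comp fst ((snd.comp snd).pair (fst.comp snd))).to₂).of_eq fun a => by
      rw [List.foldl_reverse]

theorem list_map {f : α → List β} {g : α → β → σ} (hf : Computable f) (hg : Computable₂ g) :
    Computable fun a => (f a).map (g a) :=
  (list_foldr hf (const []) (list_cons.comp (hg.comp fst (fst.comp snd))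
    (snd.comp snd)).to₂).of_eq fun a => by
      induction f a <;> simp_all

theorem list_flatMap {f : α → List β} {g : α → β → List σ} (hf : Computable f)
    (hg : Computable₂ g) : Computable fun a => (f a).flatMap (g a) :=
  (list_foldr hf (const []) (list_append.comp (hg.comp fst (fst.comp snd))
    (snd.comp snd)).to₂).of_eq fun a => by
      induction f a <;> simp_all

theorem list_any {f : α → List β} {g : α → β → Bool} (hf : Computable f) (hg : Computable₂ g) :
    Computable fun a => (f a).any (g a) :=
  (list_foldr hf (const false) (Primrec.or.to_comp.comp (hg.comp fst (fst.comp snd))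
    (snd.comp snd)).to₂).of_eq fun a => by
      induction f a <;> simp_all

end Computable

theorem Primrec.list_any {α β : Type*} [Primcodable α] [Primcodable β] {f : α → List β}
    {g : α → β → Bool} (hf : Primrec f) (hg : Primrec₂ g) : Primrec fun a => (f a).any (g a) :=
  (Primrec.list_foldr hf (Primrec.const false) (Primrec.or.comp
    (hg.comp Primrec.fst (Primrec.fst.comp Primrec.snd))
    (Primrec.snd.comp Primrec.snd)).to₂).of_eq fun a => by
      induction f a <;> simp_all

/-! ### The algorithm on input codes. -/

section Algorithm

/-- The largest successor of the elements of a list of heights. -/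
def maxSucc (l : List ℕ) : ℕ := l.foldr (fun x m => max (x + 1) m) 0

/-- Read one symbol of a prefix code from right to left, with a stack of heights.  The ranks of the
symbols are `rk`, and `hs` lists the heights of the trees that are substituted for the variables. -/
def heightStep (rk hs : List ℕ) : ℕ ⊕ ℕ → List ℕ → List ℕ
  | .inl d, st => maxSucc (st.take (rk.getD d 0)) :: st.drop (rk.getD d 0)
  | .inr i, st => hs.getD i 0 :: st

/-- The height of the tree with a given prefix code. -/
def codeHeight (rk hs : List ℕ) (code : List (ℕ ⊕ ℕ)) : ℕ :=
  (code.foldr (heightStep rk hs) []).headI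

/-- The number of occurrences of a variable in a prefix code. -/
def countVar (code : List (ℕ ⊕ ℕ)) (i : ℕ) : ℕ :=
  code.foldr (fun x n => bif decide (x = .inr i) then n + 1 else n) 0

/-- The lists of length `n` with elements in `L`. -/
def tuples {α : Type*} (L : List α) (n : ℕ) : List (List α) :=
  Nat.rec [[]] (fun _ T => T.flatMap fun t => L.map fun x => x :: t) n

variable {F : Type*}

/-- What the algorithm records about a tree: the weights of the states for its image, the height of
its image, and whether a large subtree of its image is duplicated. -/
abbrev Item (F : Type*) : Type _ := List F × ℕ × Bool

section

variable [Field F]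

/-- The weight at the state `q` of the item `j` of a list. -/
def itemWeight (xs : List (Item F)) (j q : ℕ) : F := ((xs.getD j ([], 0, false)).1).getD q 0

/-- The product of the weights of a list of states at the items of a list. -/
def statesWeight (xs : List (Item F)) (qs : List ℕ) : F :=
  (List.range qs.length).foldr (fun j a => itemWeight xs j (qs.getD j 0) * a) 1

/-- The weight at the state `q` of the tree with root `σ` and children recorded in `xs`. -/
def nodeWeight (rules : List (ℕ × List ℕ × ℕ × F)) (codes : List (List (ℕ ⊕ ℕ))) (σ : ℕ)
    (xs : List (Item F)) (q : ℕ) : F :=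
  rules.foldr (fun r a =>
    bif decide (codes.getD r.1 [] = codes.getD σ []) && decide (r.2.2.1 = q) then
      r.2.2.2 * statesWeight xs r.2.1 + a else a) 0

/-- The item of the tree with root `σ` and children recorded in `xs`. -/
def nodeItem (c : InputCode F) (N σ : ℕ) (xs : List (Item F)) : Item F :=
  ((List.range c.2.2.1).map (nodeWeight c.2.2.2.2.1 c.2.2.2.2.2 σ xs),
    codeHeight c.2.1 (xs.map fun x => x.2.1) (c.2.2.2.2.2.getD σ []),
    (xs.any fun x => x.2.2) || (List.range xs.length).any fun i =>
      decide (2 ≤ countVar (c.2.2.2.2.2.getD σ []) i) &&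
        decide (N ≤ (xs.getD i ([], 0, false)).2.1))

/-- The items of the trees of height less than `n`. -/
def level (c : InputCode F) (N n : ℕ) : List (Item F) :=
  Nat.rec [] (fun _ L => (List.range c.1.length).flatMap fun σ =>
    (tuples L (c.1.getD σ 0)).map (nodeItem c N σ)) n

variable [DecidableEq F]

/-- The item belongs to a tree in the support with a large duplicated subtree. -/
def itemAccepts (fs : List ℕ) (x : Item F) : Bool :=
  x.2.2 && !decide (fs.foldr (fun q a => x.1.getD q 0 + a) 0 = 0)

/-- Exhaustive search up to the height bound of `hasLDP_iff_exists_bounded`. -/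
def decideLDP (c : InputCode F) (N : ℕ) : Bool :=
  (level c N (c.2.2.1 * ((N + 1) * 2))).any (itemAccepts c.2.2.2.1)

end

/-- The total length of the codes bounds the height of every symbol image; the final one makes the
inequality of `isPumpingConstant_of_lt` strict. -/
def pumpingConstant {F : Type*} (c : InputCode F) : ℕ := c.2.2.2.2.2.flatten.length * c.2.2.1 + 1

end Algorithm

/-! ### Computability of the algorithm. -/

section Computability

open Primrec

theorem primrec_maxSucc : Primrec maxSucc :=
  list_foldr .id (.const 0) (nat_max.comp (succ.comp (fst.comp snd)) (snd.comp snd)).to₂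

theorem primrec_codeHeight :
    Primrec fun x : List ℕ × List ℕ × List (ℕ ⊕ ℕ) => codeHeight x.1 x.2.1 x.2.2 := by
  have hstep : Primrec₂ fun (x : List ℕ × List ℕ × List (ℕ ⊕ ℕ)) (y : (ℕ ⊕ ℕ) × List ℕ) =>
      heightStep x.1 x.2.1 y.1 y.2 := by
    have hrk : Primrec fun z : ((List ℕ × List ℕ × List (ℕ ⊕ ℕ)) × (ℕ ⊕ ℕ) × List ℕ) × ℕ =>
        z.1.1.1.getD z.2 0 :=
      (list_getD 0).comp (fst.comp (fst.comp fst)) snd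
    have hst : Primrec fun z : ((List ℕ × List ℕ × List (ℕ ⊕ ℕ)) × (ℕ ⊕ ℕ) × List ℕ) × ℕ =>
        z.1.2.2 := snd.comp (snd.comp fst)
    refine (sumCasesOn (fst.comp snd)
      (list_cons.comp (primrec_maxSucc.comp (list_take.comp hrk hst)) (list_drop.comp hrk hst)).to₂
      (list_cons.comp ((list_getD 0).comp (fst.comp (snd.comp (fst.comp fst))) snd) hst).to₂).of_eq
      fun x => ?_
    rcases x with ⟨x, d | i, st⟩ <;> rfl
  exact list_headI.comp (list_foldr (snd.comp snd) (.const []) hstep)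

theorem primrec_countVar : Primrec₂ countVar :=
  list_foldr fst (.const 0) (cond
    (Primrec.eq.decide.comp (fst.comp snd) (sumInr.comp (snd.comp fst)))
    (succ.comp (snd.comp snd)) (snd.comp snd)).to₂

theorem primrec_tuples {α : Type*} [Primcodable α] : Primrec₂ (tuples (α := α)) :=
  nat_rec' snd (.const [[]]) (list_flatMap (snd.comp snd)
    (list_map (fst.comp (fst.comp fst)) (list_cons.comp snd (snd.comp fst)).to₂).to₂).to₂

variable {F : Type*} [Field F] [Primcodable F]

theorem primrec_itemWeight :
    Primrec fun x : List (Item F) × ℕ × ℕ => itemWeight x.1 x.2.1 x.2.2 :=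
  (list_getD 0).comp (fst.comp ((list_getD _).comp fst (fst.comp snd))) (snd.comp snd)

/-- Field operations are only assumed computable, so everything that depends on them leaves the
primitive recursive setting here. -/
theorem computable_statesWeight (hmul : Computable₂ fun a b : F => a * b) :
    Computable₂ (statesWeight (F := F)) :=
  Computable.list_foldr (list_range.comp (list_length.comp snd)).to_comp (.const 1)
    (hmul.comp (primrec_itemWeight.comp (pair (fst.comp fst) (pair (fst.comp snd)
      ((list_getD 0).comp (snd.comp fst) (fst.comp snd))))).to_comp (snd.comp snd).to_comp).to₂

/-- The arguments of the step function of `nodeWeight`. -/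
abbrev WeightState (F : Type*) : Type _ :=
  ((List (ℕ × List ℕ × ℕ × F) × List (List (ℕ ⊕ ℕ))) × ℕ × List (Item F) × ℕ) ×
    (ℕ × List ℕ × ℕ × F) × F

theorem computable_nodeWeight (hadd : Computable₂ fun a b : F => a + b)
    (hmul : Computable₂ fun a b : F => a * b) :
    Computable fun x : (List (ℕ × List ℕ × ℕ × F) × List (List (ℕ ⊕ ℕ))) ×
      ℕ × List (Item F) × ℕ => nodeWeight x.1.1 x.1.2 x.2.1 x.2.2.1 x.2.2.2 := by
  have hcodes : Primrec fun y : WeightState F => y.1.1.2 := snd.comp (fst.comp fst)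
  have hσ : Primrec fun y : WeightState F => y.1.2.1 := fst.comp (snd.comp fst)
  have hxs : Primrec fun y : WeightState F => y.1.2.2.1 := fst.comp (snd.comp (snd.comp fst))
  have hq : Primrec fun y : WeightState F => y.1.2.2.2 := snd.comp (snd.comp (snd.comp fst))
  have hr : Primrec fun y : WeightState F => y.2.1 := fst.comp snd
  have ha : Primrec fun y : WeightState F => y.2.2 := snd.comp snd
  have hcond : Primrec fun y : WeightState F => decide (y.1.1.2.getD y.2.1.1 [] = y.1.1.2.getD y.1.2.1 []) &&
      decide (y.2.1.2.2.1 = y.1.2.2.2) :=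
    Primrec.and.comp
      (Primrec.eq.decide.comp ((list_getD []).comp hcodes (fst.comp hr))
        ((list_getD []).comp hcodes hσ))
      (Primrec.eq.decide.comp (fst.comp (snd.comp (snd.comp hr))) hq)
  have hprod : Computable fun y : WeightState F => statesWeight y.1.2.2.1 y.2.1.2.1 :=
    (computable_statesWeight hmul).comp hxs.to_comp (fst.comp (snd.comp hr)).to_comp
  have hval : Computable fun y : WeightState F => y.2.1.2.2.2 * statesWeight y.1.2.2.1 y.2.1.2.1 + y.2.2 :=
    hadd.comp (hmul.comp (snd.comp (snd.comp (snd.comp hr))).to_comp hprod) ha.to_comp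
  have hstep : Computable fun y : WeightState F =>
      bif decide (y.1.1.2.getD y.2.1.1 [] = y.1.1.2.getD y.1.2.1 []) &&
        decide (y.2.1.2.2.1 = y.1.2.2.2) then
      y.2.1.2.2.2 * statesWeight y.1.2.2.1 y.2.1.2.1 + y.2.2 else y.2.2 :=
    Computable.cond hcond.to_comp hval ha.to_comp
  have hrules : Primrec fun x : (List (ℕ × List ℕ × ℕ × F) × List (List (ℕ ⊕ ℕ))) ×
      ℕ × List (Item F) × ℕ => x.1.1 := fst.comp fst
  have := Computable.list_foldr hrules.to_comp (.const (0 : F)) hstep.to₂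
  exact this.of_eq fun x => by rw [nodeWeight]

theorem computable_nodeItem (hadd : Computable₂ fun a b : F => a + b)
    (hmul : Computable₂ fun a b : F => a * b) :
    Computable fun x : (InputCode F × ℕ) × ℕ × List (Item F) =>
      nodeItem x.1.1 x.1.2 x.2.1 x.2.2 := by
  have hcodes : Primrec fun x : (InputCode F × ℕ) × ℕ × List (Item F) => x.1.1.2.2.2.2.2 :=
    snd.comp (snd.comp (snd.comp (snd.comp (snd.comp (fst.comp fst)))))
  have hrules : Primrec fun x : (InputCode F × ℕ) × ℕ × List (Item F) => x.1.1.2.2.2.2.1 :=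
    fst.comp (snd.comp (snd.comp (snd.comp (snd.comp (fst.comp fst)))))
  have hk : Primrec fun x : (InputCode F × ℕ) × ℕ × List (Item F) => x.1.1.2.2.1 :=
    fst.comp (snd.comp (snd.comp (fst.comp fst)))
  have hcode : Primrec fun x : (InputCode F × ℕ) × ℕ × List (Item F) =>
      x.1.1.2.2.2.2.2.getD x.2.1 [] := (list_getD []).comp hcodes (fst.comp snd)
  have hxs : Primrec fun x : (InputCode F × ℕ) × ℕ × List (Item F) => x.2.2 := snd.comp snd
  refine Computable.pair ?_ (Primrec.pair ?_ ?_).to_comp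
  · exact Computable.list_map (list_range.comp hk).to_comp
      ((computable_nodeWeight hadd hmul).comp (pair (pair (hrules.comp fst) (hcodes.comp fst))
        (pair (fst.comp (snd.comp fst)) (pair (hxs.comp fst) snd))).to_comp).to₂
  · exact primrec_codeHeight.comp (pair (fst.comp (snd.comp (fst.comp fst)))
      (pair (list_map hxs (fst.comp (snd.comp snd)).to₂) hcode))
  · refine Primrec.or.comp (Primrec.list_any hxs (snd.comp (snd.comp snd)).to₂)
      (Primrec.list_any (list_range.comp (list_length.comp hxs)) ?_)
    exact (Primrec.and.comp
      (nat_le.decide.comp (.const 2) (primrec_countVar.comp (hcode.comp fst) snd))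
      (nat_le.decide.comp (snd.comp (fst.comp fst))
        (fst.comp (snd.comp ((list_getD _).comp (hxs.comp fst) snd))))).to₂

/-- The arguments of the step function of `level`. -/
abbrev LevelState (F : Type*) : Type _ := ((InputCode F × ℕ) × ℕ) × ℕ × List (Item F)

theorem computable_level (hadd : Computable₂ fun a b : F => a + b)
    (hmul : Computable₂ fun a b : F => a * b) :
    Computable fun x : (InputCode F × ℕ) × ℕ => level x.1.1 x.1.2 x.2 := by
  have hc : Primrec fun y : LevelState F => y.1.1.1 := fst.comp (fst.comp fst)
  have harg : Primrec fun z : (LevelState F × ℕ) × List (Item F) => (z.1.1.1.1, z.1.2, z.2) :=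
    pair (fst.comp (fst.comp (fst.comp fst))) (pair (snd.comp fst) snd)
  have hitem := (computable_nodeItem hadd hmul).comp harg.to_comp
  have htup : Primrec fun z : LevelState F × ℕ => tuples z.1.2.2 (z.1.1.1.1.1.getD z.2 0) :=
    primrec_tuples.comp (snd.comp (snd.comp fst))
      ((list_getD 0).comp (fst.comp (hc.comp fst)) snd)
  have hmap : Computable fun z : LevelState F × ℕ =>
      (tuples z.1.2.2 (z.1.1.1.1.1.getD z.2 0)).map (nodeItem z.1.1.1.1 z.1.1.1.2 z.2) :=
    Computable.list_map htup.to_comp hitem.to₂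
  have hrange : Primrec fun y : LevelState F => List.range y.1.1.1.1.length :=
    list_range.comp (list_length.comp (fst.comp hc))
  have hstep : Computable fun y : LevelState F => (List.range y.1.1.1.1.length).flatMap fun σ =>
      (tuples y.2.2 (y.1.1.1.1.getD σ 0)).map (nodeItem y.1.1.1 y.1.1.2 σ) :=
    Computable.list_flatMap hrange.to_comp hmap.to₂
  have := Computable.nat_rec Computable.snd (.const ([] : List (Item F))) hstep.to₂
  exact this.of_eq fun x => by rw [level]

theorem computable_decideLDP [DecidableEq F] (hadd : Computable₂ fun a b : F => a + b)
    (hmul : Computable₂ fun a b : F => a * b) :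
    Computable fun x : InputCode F × ℕ => decideLDP x.1 x.2 := by
  have hk : Primrec fun x : InputCode F × ℕ => x.1.2.2.1 * ((x.2 + 1) * 2) :=
    nat_mul.comp (fst.comp (snd.comp (snd.comp fst))) (nat_mul.comp (succ.comp snd) (.const 2))
  have hfs : Primrec fun x : (InputCode F × ℕ) × Item F => x.1.1.2.2.2.1 :=
    fst.comp (snd.comp (snd.comp (snd.comp (fst.comp fst))))
  have hget : Primrec fun y : ((InputCode F × ℕ) × Item F) × ℕ × F => y.1.2.1.getD y.2.1 0 :=
    (list_getD 0).comp (fst.comp (snd.comp fst)) (fst.comp snd)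
  have ha : Primrec fun y : ((InputCode F × ℕ) × Item F) × ℕ × F => y.2.2 := snd.comp snd
  have hstep : Computable fun y : ((InputCode F × ℕ) × Item F) × ℕ × F => y.1.2.1.getD y.2.1 0 + y.2.2 :=
    hadd.comp hget.to_comp ha.to_comp
  have hsum := Computable.list_foldr hfs.to_comp (.const (0 : F)) hstep.to₂
  -- The zero test compares codes and needs no assumption on the field operations.
  have hdec : Primrec fun a : F => !decide (a = 0) :=
    Primrec.not.comp (Primrec.eq.decide.comp .id (.const 0))
  have hflag : Primrec fun x : (InputCode F × ℕ) × Item F => x.2.2.2 := snd.comp (snd.comp snd)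
  have hand := Primrec.and.to_comp.comp hflag.to_comp (hdec.to_comp.comp hsum)
  have hacc : Computable fun x : (InputCode F × ℕ) × Item F => itemAccepts x.1.1.2.2.2.1 x.2 :=
    hand.of_eq fun x => by rw [itemAccepts]
  have harg : Primrec fun x : InputCode F × ℕ => (x, x.1.2.2.1 * ((x.2 + 1) * 2)) := pair .id hk
  have hlev := (computable_level hadd hmul).comp harg.to_comp
  have hacc₂ : Computable₂ fun (x : InputCode F × ℕ) (y : Item F) =>
      itemAccepts x.1.2.2.2.1 y := hacc
  have := Computable.list_any hlev hacc₂
  exact this.of_eq fun x => by rw [decideLDP]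

theorem computable_pumpingConstant {F : Type*} [Primcodable F] :
    Computable (pumpingConstant (F := F)) :=
  (succ.comp (nat_mul.comp
    (list_length.comp (list_flatten.comp (snd.comp (snd.comp (snd.comp (snd.comp snd))))))
    (fst.comp (snd.comp snd)))).to_comp

end Computability

/-! ### Lists, prefix codes, and what can be read off from them. -/

section Lists

theorem List.getD_ofFn {α : Type*} {n : ℕ} (f : Fin n → α) (i : Fin n) (d : α) :
    (List.ofFn f).getD i d = f i := by
  simp [List.getD_eq_getElem?_getD]

theorem maxSucc_ofFn {n : ℕ} (a : Fin n → ℕ) :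
    maxSucc (List.ofFn a) = Finset.univ.sup fun i => a i + 1 := by
  induction n with
  | zero => rfl
  | succ n ih =>
    rw [List.ofFn_succ, maxSucc, List.foldr_cons, ← maxSucc, ih, Fin.univ_succ, Finset.sup_cons,
      Finset.sup_map]
    rfl

theorem foldr_flatten_ofFn {α β : Type*} (f : α → List β → List β) {n : ℕ} {g : Fin n → List α}
    {a : Fin n → β} (h : ∀ i st, (g i).foldr f st = a i :: st) (st : List β) :
    (List.ofFn g).flatten.foldr f st = List.ofFn a ++ st := by
  induction n with
  | zero => simp
  | succ n ih =>
    simp only [List.ofFn_succ, List.flatten_cons, List.foldr_append, List.cons_append]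
    rw [ih fun i => h i.succ, h]

theorem mem_tuples {α : Type*} {L l : List α} {n : ℕ} :
    l ∈ tuples L n ↔ l.length = n ∧ ∀ x ∈ l, x ∈ L := by
  induction n generalizing l with
  | zero => simp +contextual [tuples, List.length_eq_zero_iff, iff_def]
  | succ n ih =>
    have : tuples L (n + 1) = (tuples L n).flatMap fun t => L.map fun x => x :: t := rfl
    simp only [this, List.mem_flatMap, List.mem_map, ih]
    constructor
    · rintro ⟨t, ⟨rfl, h⟩, x, hx, rfl⟩
      exact ⟨rfl, by simpa using ⟨hx, h⟩⟩
    · rintro ⟨h1, h2⟩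
      cases l with
      | nil => simp at h1
      | cons x t =>
        simp only [List.mem_cons, forall_eq_or_imp] at h2
        exact ⟨t, ⟨by simpa using h1, h2.2⟩, x, h2.1, rfl⟩

theorem foldr_range_eq_prod {F : Type*} [CommMonoid F] (n : ℕ) (f : ℕ → F) :
    (List.range n).foldr (fun j a => f j * a) 1 = ∏ j : Fin n, f j := by
  rw [Fin.prod_univ_eq_prod_range f n, Finset.prod, Finset.range_val, Multiset.range,
    Multiset.map_coe, Multiset.prod_coe, List.prod, List.foldr_map]

theorem foldr_eq_sum_map {F α : Type*} [AddCommMonoid F] (l : List α) (f : α → F) :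
    l.foldr (fun x a => f x + a) 0 = (l.map f).sum := by
  rw [List.sum, List.foldr_map]

end Lists

namespace RTree

variable {n k k' : ℕ} {rk : Fin n → ℕ}

/-- The stack invariant: reading the code of a tree from right to left pushes exactly one number,
and a symbol finds the heights of its children on top of the stack in the right order. -/
theorem prefixCode_foldr {Z : Type} (u : RTree rk (Fin k)) (θ : Fin k → RTree rk Z)
    {hs : List ℕ} (hhs : ∀ i : Fin k, hs.getD i 0 = (θ i).height) (st : List ℕ) :
    u.prefixCode.foldr (heightStep (List.ofFn rk) hs) st = (u.subst θ).height :: st := by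
  induction u generalizing st with
  | var i =>
    rw [prefixCode, List.foldr_cons, List.foldr_nil, heightStep, hhs]
    rfl
  | node s ts ih =>
    rw [prefixCode, List.foldr_cons, foldr_flatten_ofFn _ ih, heightStep, List.getD_ofFn,
      List.take_left' (List.length_ofFn), List.drop_left' (List.length_ofFn), maxSucc_ofFn]
    rfl

/-- Polish notation is uniquely readable; the arbitrary remainders make the induction through the
children work. Variables are compared in `ℕ` because `k` and `k'` may differ. -/
theorem prefixCode_append_inj (t : RTree rk (Fin k)) (t' : RTree rk (Fin k'))
    {l l' : List (ℕ ⊕ ℕ)} (h : t.prefixCode ++ l = t'.prefixCode ++ l') :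
    (t.subst fun i => (.var i.val : RTree rk ℕ)) = t'.subst (fun i => .var i.val) ∧ l = l' := by
  induction t generalizing t' l l' with
  | var i =>
    cases t' with
    | var i' =>
      simp only [prefixCode, List.cons_append, List.nil_append, List.cons.injEq,
        Sum.inr.injEq] at h
      exact ⟨by simp [subst, fill, h.1], h.2⟩
    | node s' ts' => simp [prefixCode] at h
  | node s ts ih =>
    cases t' with
    | var i' => simp [prefixCode] at h
    | node s' ts' =>
      simp only [prefixCode, List.cons_append, List.cons.injEq, Sum.inl.injEq, Fin.val_inj] at h
      obtain ⟨rfl, h⟩ := h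
      have key : ∀ (r : ℕ) (f : Fin r → RTree rk (Fin k)) (f' : Fin r → RTree rk (Fin k'))
          (_ : ∀ (i : Fin r) (t' : RTree rk (Fin k')) {l l' : List (ℕ ⊕ ℕ)},
            (f i).prefixCode ++ l = t'.prefixCode ++ l' →
            ((f i).subst fun i => (.var i.val : RTree rk ℕ)) = t'.subst (fun i => .var i.val) ∧
              l = l')
          (_ : (List.ofFn fun i => (f i).prefixCode).flatten ++ l =
            (List.ofFn fun i => (f' i).prefixCode).flatten ++ l'),
          (∀ i, ((f i).subst fun i => (.var i.val : RTree rk ℕ)) =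
            (f' i).subst fun i => .var i.val) ∧ l = l' := by
        intro r f f' hf e
        induction r with
        | zero => exact ⟨fun i => i.elim0, by simpa using e⟩
        | succ r ihr =>
          simp only [List.ofFn_succ, List.flatten_cons, List.append_assoc] at e
          obtain ⟨e1, e2⟩ := hf 0 _ e
          obtain ⟨e3, e4⟩ := ihr (fun i => f i.succ) (fun i => f' i.succ)
            (fun i => hf i.succ) e2
          exact ⟨Fin.cases e1 e3, e4⟩
      obtain ⟨h1, h2⟩ := key _ ts ts' (fun i => ih i) h
      exact ⟨by simp only [subst_node, h1], h2⟩

theorem height_lt_length_prefixCode (u : RTree rk (Fin k)) : u.height < u.prefixCode.length := by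
  induction u with
  | var i => simp [height, prefixCode]
  | node s ts ih =>
    simp only [height, prefixCode, List.length_cons, List.length_flatten, List.map_ofFn,
      List.sum_ofFn, Function.comp_apply]
    refine Nat.lt_succ_of_le (Finset.sup_le fun i _ => ?_)
    exact (ih i).trans_le
      (Finset.single_le_sum (f := fun i => (ts i).prefixCode.length) (fun _ _ => Nat.zero_le _)
        (Finset.mem_univ i))

theorem countVar_eq_countP (code : List (ℕ ⊕ ℕ)) (i : ℕ) :
    countVar code i = code.countP fun x => decide (x = .inr i) := by
  induction code with
  | nil => rfl
  | cons x code ih =>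
    rw [countVar, List.foldr_cons, ← countVar, ih, List.countP_cons]
    by_cases hx : x = .inr i <;> simp [hx]

theorem countVar_prefixCode_var (i : Fin k) (j : ℕ) :
    countVar (var i : RTree rk (Fin k)).prefixCode j = if i.val = j then 1 else 0 := by
  by_cases h : i.val = j <;> simp [countVar, prefixCode, h]

theorem countVar_prefixCode_node (s : Fin n) (ts : Fin (rk s) → RTree rk (Fin k)) (j : ℕ) :
    countVar (node s ts).prefixCode j = ∑ i, countVar (ts i).prefixCode j := by
  simp only [countVar_eq_countP]
  rw [prefixCode, List.countP_cons_of_neg (by simp), List.countP_flatten, List.map_ofFn,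
    List.sum_ofFn]
  rfl

theorem countVar_prefixCode_pos (u : RTree rk (Fin k)) (j : Fin k) :
    0 < countVar u.prefixCode j ↔ ∃ p, u.sub p = some (var j) := by
  induction u with
  | var i =>
    rw [countVar_prefixCode_var]
    constructor
    · intro h
      split_ifs at h with hi
      · exact ⟨[], by simp [Fin.ext hi]⟩
      · simp at h
    · rintro ⟨p, hp⟩
      cases p <;> simp_all [sub]
  | node s ts ih =>
    rw [countVar_prefixCode_node, Finset.sum_pos_iff]
    constructor
    · rintro ⟨i, -, hi⟩
      obtain ⟨p, hp⟩ := (ih i).1 hi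
      exact ⟨i :: p, by simp [sub, hp]⟩
    · rintro ⟨p, hp⟩
      cases p with
      | nil => simp at hp
      | cons i p =>
        simp only [sub] at hp
        split_ifs at hp with hi
        exact ⟨⟨i, hi⟩, Finset.mem_univ _, (ih _).2 ⟨p, hp⟩⟩

theorem two_le_sum_iff {ι : Type*} [Fintype ι] (f : ι → ℕ) :
    2 ≤ ∑ i, f i ↔ (∃ i, 2 ≤ f i) ∨ ∃ i i', i ≠ i' ∧ 0 < f i ∧ 0 < f i' := by
  classical
  constructor
  · intro h
    by_contra! hcon
    obtain ⟨h1, h2⟩ := hcon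
    obtain ⟨i, -, hi⟩ := Finset.exists_ne_zero_of_sum_ne_zero (s := Finset.univ) (f := f) (by omega)
    rw [← Finset.add_sum_erase _ _ (Finset.mem_univ i), Finset.sum_eq_zero] at h
    · have := h1 i
      omega
    · intro i' hi'
      have := h2 i i' (Finset.ne_of_mem_erase hi').symm (Nat.pos_of_ne_zero hi)
      omega
  · rintro (⟨i, hi⟩ | ⟨i, i', hne, hi, hi'⟩)
    · exact hi.trans (Finset.single_le_sum (f := f) (fun _ _ => Nat.zero_le _) (Finset.mem_univ i))
    · rw [← Finset.add_sum_erase _ _ (Finset.mem_univ i)]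
      have := Finset.single_le_sum (f := f) (fun _ _ => Nat.zero_le _)
        (Finset.mem_erase.2 ⟨hne.symm, Finset.mem_univ i'⟩)
      omega

theorem two_le_countVar_prefixCode (u : RTree rk (Fin k)) (j : Fin k) :
    2 ≤ countVar u.prefixCode j ↔
      ∃ p p', p ≠ p' ∧ u.sub p = some (var j) ∧ u.sub p' = some (var j) := by
  induction u with
  | var i =>
    constructor
    · intro h
      rw [countVar_prefixCode_var] at h
      split_ifs at h <;> omega
    · rintro ⟨p, p', hne, hp, hp'⟩
      cases p <;> cases p' <;> simp_all [sub]
  | node s ts ih =>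
    rw [countVar_prefixCode_node, two_le_sum_iff]
    simp only [ih, countVar_prefixCode_pos]
    constructor
    · rintro (⟨i, p, p', hne, hp, hp'⟩ | ⟨i, i', hne, ⟨p, hp⟩, p', hp'⟩)
      · exact ⟨i :: p, i :: p', by simpa using hne, by simp [sub, hp], by simp [sub, hp']⟩
      · exact ⟨i :: p, i' :: p', by simp [Fin.val_inj, hne], by simp [sub, hp], by simp [sub, hp']⟩
    · rintro ⟨p, p', hne, hp, hp'⟩
      cases p with
      | nil => simp at hp
      | cons i p =>
        cases p' with
        | nil => simp at hp'
        | cons i' p' =>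
          simp only [sub] at hp hp'
          split_ifs at hp hp' with hi hi'
          by_cases he : i = i'
          · subst he
            exact .inl ⟨⟨i, hi⟩, p, p', by simpa using hne, hp, hp'⟩
          · exact .inr ⟨⟨i, hi⟩, ⟨i', hi'⟩, by simpa using he, ⟨p, hp⟩, p', hp'⟩

end RTree

theorem prefixCode_eq_iff {m n : ℕ} {rkS : Fin m → ℕ} {rkD : Fin n → ℕ} {h : TreeHom rkS rkD}
    (hd : h.Nondeleting) {a b : Fin m} :
    RTree.prefixCode (h a) = RTree.prefixCode (h b) ↔ h.symbolImage a = h.symbolImage b := by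
  constructor
  · intro e
    exact (prefixCode_append_inj (h a) (h b) (l := []) (l' := []) (by simpa using e)).1
  · intro e
    exact congrArg (fun x : Σ k, RTree rkD (Fin k) => x.2.prefixCode) (hd.sigma_eq e)

/-! ### Correctness of the algorithm. -/

section Correctness

variable {F : Type*} [Field F] {m n k : ℕ} {rkS : Fin m → ℕ} {rkD : Fin n → ℕ}
  {A : WTA F (Fin k) rkS} {h : TreeHom rkS rkD} {c : InputCode F}

open Classical in
/-- The item of a tree. -/
noncomputable def treeItem (A : WTA F (Fin k) rkS) (hT : h.TetrisFree) (N : ℕ)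
    (s : RTree rkS Empty) : Item F :=
  (List.ofFn (imageVec A hT s), (h.apply s).height, decide (h.LargeDup N s))

theorem treeItem_flag (hT : h.TetrisFree) (N : ℕ) (s : RTree rkS Empty) :
    (treeItem A hT N s).2.2 = true ↔ h.LargeDup N s := by
  simp [treeItem]

theorem itemWeight_treeItem (hT : h.TetrisFree) {N r : ℕ} (ss : Fin r → RTree rkS Empty)
    (j : Fin r) (q : Fin k) :
    itemWeight (List.ofFn fun i => treeItem A hT N (ss i)) j q = imageVec A hT (ss j) q := by
  rw [itemWeight, List.getD_ofFn, treeItem, List.getD_ofFn]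

theorem statesWeight_ofFn (xs : List (Item F)) {r : ℕ} (qs : Fin r → Fin k) :
    statesWeight xs (List.ofFn fun i => (qs i).val) = ∏ j : Fin r, itemWeight xs j (qs j).val := by
  rw [statesWeight, List.length_ofFn,
    foldr_range_eq_prod r fun j => itemWeight xs j ((List.ofFn fun i => (qs i).val).getD j 0)]
  exact Finset.prod_congr rfl fun j _ => by rw [List.getD_ofFn]

/-- The algorithm adds up rules whose symbols have the same code as `σ`. Equal codes mean equal
symbol images, which is the condition in `stateWeight_node_eq_sum_rules`; as the rules are listed
without repetition, the list sum is the sum over `A.rules`. -/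
theorem nodeWeight_eq (hc : IsInputCode c A h) (hT : h.TetrisFree) (N : ℕ) (σ : Fin m)
    (ss : Fin (rkS σ) → RTree rkS Empty) (q : Fin k) :
    nodeWeight c.2.2.2.2.1 c.2.2.2.2.2 σ (List.ofFn fun i => treeItem A hT N (ss i)) q =
      imageVec A hT (.node σ ss) q := by
  classical
  obtain ⟨fs, rs, -, -, hnd, hrs, rfl⟩ := hc
  simp only
  generalize hxs : (List.ofFn fun i => treeItem A hT N (ss i)) = xs
  rw [imageVec, stateWeight_node_eq_sum_rules hT σ ss q (fun j q' => itemWeight xs j q')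
    fun j q' => by rw [← hxs, itemWeight_treeItem]; rfl, Finset.sum_filter]
  have hA : A.rules = rs.toFinset := by
    ext r
    rw [List.mem_toFinset, hrs]
  rw [hA, List.sum_toFinset _ hnd, ← foldr_eq_sum_map, nodeWeight, List.foldr_map]
  congr 1
  funext r a
  simp only [List.getD_ofFn, statesWeight_ofFn, prefixCode_eq_iff hT.nondeleting, Fin.val_inj]
  by_cases h1 : h.symbolImage r.sym = h.symbolImage σ <;> by_cases h2 : r.target = q <;>
    simp [h1, h2]

theorem codeHeight_eq (hT : h.TetrisFree) (N : ℕ) (σ : Fin m)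
    (ss : Fin (rkS σ) → RTree rkS Empty) :
    codeHeight (List.ofFn rkD) ((List.ofFn fun i => treeItem A hT N (ss i)).map fun x => x.2.1)
      (RTree.prefixCode (h σ)) = (h.apply (.node σ ss)).height := by
  rw [codeHeight, prefixCode_foldr (h σ) fun i => h.apply (ss i)]
  · rw [TreeHom.apply_node]
    rfl
  · intro i
    rw [List.map_ofFn, List.getD_ofFn]
    rfl

theorem nodeItem_eq (hc : IsInputCode c A h) (hT : h.TetrisFree) (N : ℕ) (σ : Fin m)
    (ss : Fin (rkS σ) → RTree rkS Empty) :
    nodeItem c N σ (List.ofFn fun i => treeItem A hT N (ss i)) = treeItem A hT N (.node σ ss) := by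
  have hw := nodeWeight_eq hc hT N σ ss
  obtain ⟨fs, rs, -, -, -, -, rfl⟩ := hc
  refine Prod.ext ?_ (Prod.ext ?_ ?_)
  · refine List.ext_getElem (by simp [nodeItem, treeItem]) fun q h1 h2 => ?_
    have hq : q < k := by simpa [nodeItem] using h1
    simpa [nodeItem, treeItem] using hw ⟨q, hq⟩
  · simp only [nodeItem, List.getD_ofFn]
    exact codeHeight_eq hT N σ ss
  · simp only [nodeItem, List.getD_ofFn]
    rw [Bool.eq_iff_iff]
    simp only [treeItem_flag, Bool.or_eq_true, List.any_eq_true, List.mem_ofFn, decide_eq_true_eq,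
      List.mem_range, List.length_ofFn, Bool.and_eq_true, TreeHom.largeDup_node]
    refine or_congr ?_ ?_
    · constructor
      · rintro ⟨_, ⟨i, rfl⟩, hi⟩
        exact ⟨i, (treeItem_flag hT N _).1 hi⟩
      · rintro ⟨i, hi⟩
        exact ⟨_, ⟨i, rfl⟩, (treeItem_flag hT N _).2 hi⟩
    · constructor
      · rintro ⟨i, hi, h1, h2⟩
        rw [List.getD_ofFn _ (⟨i, hi⟩ : Fin (rkS σ))] at h2
        exact ⟨⟨i, hi⟩, (two_le_countVar_prefixCode (h σ) ⟨i, hi⟩).1 h1, h2⟩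
      · rintro ⟨i, h1, h2⟩
        refine ⟨i, i.2, (two_le_countVar_prefixCode (h σ) i).2 h1, ?_⟩
        rw [List.getD_ofFn]
        exact h2

theorem mem_level (hc : IsInputCode c A h) (hT : h.TetrisFree) {N l : ℕ} {y : Item F} :
    y ∈ level c N l ↔ ∃ s : RTree rkS Empty, s.height < l ∧ treeItem A hT N s = y := by
  induction l generalizing y with
  | zero => simp [level]
  | succ l ih =>
    have hstep : level c N (l + 1) = (List.range c.1.length).flatMap fun σ =>
      (tuples (level c N l) (c.1.getD σ 0)).map (nodeItem c N σ) := rfl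
    have hc1 : c.1 = List.ofFn rkS := by
      obtain ⟨fs, rs, -, -, -, -, rfl⟩ := hc
      rfl
    simp only [hstep, hc1, List.mem_flatMap, List.mem_range, List.length_ofFn, List.mem_map,
      mem_tuples]
    constructor
    · rintro ⟨σ, hσ, xs, ⟨h1, h2⟩, rfl⟩
      rw [List.getD_ofFn _ (⟨σ, hσ⟩ : Fin m)] at h1
      have h3 : ∀ i : Fin (rkS ⟨σ, hσ⟩), ∃ s : RTree rkS Empty, s.height < l ∧
          treeItem A hT N s = xs[i.val]'(i.2.trans_eq h1.symm) := fun i => ih.1 (h2 _ (List.getElem_mem _))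
      choose ss h4 h5 using h3
      refine ⟨.node ⟨σ, hσ⟩ ss, ?_, ?_⟩
      -- Positivity of the bound covers symbols of rank zero, where the supremum is empty.
      · exact (Finset.sup_lt_iff (Nat.succ_pos l)).2 fun i _ => Nat.succ_lt_succ (h4 i)
      · rw [← nodeItem_eq hc hT N ⟨σ, hσ⟩ ss]
        congr 1
        exact List.ext_getElem (by simp [h1]) fun i h6 h7 => by simp [h5]
    · rintro ⟨s, hs, rfl⟩
      cases s with
      | var e => exact e.elim
      | node σ ss =>
        refine ⟨σ, σ.2, List.ofFn fun i => treeItem A hT N (ss i), ⟨?_, ?_⟩, ?_⟩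
        · rw [List.length_ofFn, List.getD_ofFn]
        · intro x hx
          obtain ⟨i, rfl⟩ := List.mem_ofFn.1 hx
          refine ih.2 ⟨ss i, ?_, rfl⟩
          have := height_child_lt σ ss i
          omega
        · exact nodeItem_eq hc hT N σ ss

theorem itemAccepts_treeItem [DecidableEq F] (hc : IsInputCode c A h) (hT : h.TetrisFree) {N : ℕ}
    (s : RTree rkS Empty) : itemAccepts c.2.2.2.1 (treeItem A hT N s) = true ↔
      h.LargeDup N s ∧ (imageWTAh A h hT.nonerasing).series (h.apply s) ≠ 0 := by
  obtain ⟨fs, rs, hnd, hfs, -, -, rfl⟩ := hc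
  have hA : A.final = fs.toFinset := by
    ext q
    rw [List.mem_toFinset, hfs]
  have hsum : (fs.map Fin.val).foldr (fun q a => (treeItem A hT N s).1.getD q 0 + a) 0 =
      (imageWTAh A h hT.nonerasing).series (h.apply s) := by
    rw [series_eq_sum, hA, List.sum_toFinset _ hnd, ← foldr_eq_sum_map, List.foldr_map]
    simp only [treeItem, List.getD_ofFn]
    rfl
  rw [itemAccepts, hsum]
  simp [treeItem]

theorem decideLDP_iff [DecidableEq F] (hc : IsInputCode c A h) (hT : h.TetrisFree) (N : ℕ) :
    decideLDP c N = true ↔ (imageWTAh A h hT.nonerasing).HasLDP N := by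
  have hk : c.2.2.1 = k := by
    obtain ⟨fs, rs, -, -, -, -, rfl⟩ := hc
    rfl
  rw [hasLDP_iff_exists_bounded hT, decideLDP, List.any_eq_true, Fintype.card_fin, hk]
  constructor
  · rintro ⟨y, hy, h1⟩
    obtain ⟨s, hs, rfl⟩ := (mem_level hc hT).1 hy
    obtain ⟨h2, h3⟩ := (itemAccepts_treeItem hc hT s).1 h1
    exact ⟨s, h3, h2, hs⟩
  · rintro ⟨s, h1, h2, h3⟩
    exact ⟨_, (mem_level hc hT).2 ⟨s, h3, rfl⟩, (itemAccepts_treeItem hc hT s).2 ⟨h2, h1⟩⟩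

theorem isPumpingConstant_pumpingConstant (hc : IsInputCode c A h) (hT : h.TetrisFree) :
    (imageWTAh A h hT.nonerasing).IsPumpingConstant (pumpingConstant c) := by
  obtain ⟨fs, rs, -, -, -, -, rfl⟩ := hc
  refine isPumpingConstant_of_lt hT
    (M := (List.ofFn fun s => RTree.prefixCode (h s)).flatten.length) (fun σ => ?_) ?_
  · refine (height_lt_length_prefixCode (h σ)).le.trans ?_
    rw [List.length_flatten, List.map_ofFn, List.sum_ofFn]
    exact Finset.single_le_sum (f := fun s => (RTree.prefixCode (h s)).length)
      (fun _ _ => Nat.zero_le _) (Finset.mem_univ σ)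
  · rw [Fintype.card_fin]
    exact Nat.lt_succ_self _

end Correctness

theorem mainTheorem3 {F : Type*} [Field F] [Primcodable F]
    (hadd : Computable₂ fun a b : F => a + b) (hmul : Computable₂ fun a b : F => a * b) :
    ∃ (pumpConst : InputCode F → ℕ) (dec : InputCode F × ℕ →. Bool),
      Computable pumpConst ∧ Partrec dec ∧
      ∀ (m n k : ℕ) (rkS : Fin m → ℕ) (rkD : Fin n → ℕ) (A : WTA F (Fin k) rkS)
        (h : TreeHom rkS rkD) (hT : h.TetrisFree) (c : InputCode F), IsInputCode c A h →
        (imageWTAh A h hT.nonerasing).IsPumpingConstant (pumpConst c) ∧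
        ∀ N : ℕ, ∃ b ∈ dec (c, N), (b = true ↔ (imageWTAh A h hT.nonerasing).HasLDP N) := by
  classical
  refine ⟨pumpingConstant, fun x => Part.some (decideLDP x.1 x.2), computable_pumpingConstant,
    computable_decideLDP hadd hmul, fun m n k rkS rkD A h hT c hc =>
      ⟨isPumpingConstant_pumpingConstant hc hT, fun N =>
        ⟨decideLDP c N, Part.mem_some _, decideLDP_iff hc hT N⟩⟩⟩
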